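/- Let $\mathbb{L}^2=(\mathbb{Z}^2,\mathcal{E})$ be the square lattice with nearest-neighbour edges. For $\Gamma\subset\mathbb{Z}^2$ let $\mathcal{E}(\Gamma)$ be the set of edges with both end-vertices in $\Gamma$, and let $\partial\Gamma$ be the set of vertices of $\Gamma$ adjacent to a vertex outside $\Gamma$. For $(r,s)\in\mathbb{Z}^2$ put $$\Lambda_{r,s}=(6r,5s)+\{0,\dots,5\}\times\{0,\dots,4\},\qquad \overline{\Lambda}_{r,s}=(6r,5s)+\{1,2,3,4\}\times\{1,2,3\},$$ let $g_{r,s}$ be the edge joining $(6r+2,5s+2)$ and $(6r+3,5s+2)$, and let $A_{r,s}$ be the set of edges of $\mathcal{E}(\overline{\Lambda}_{r,s})$ with exactly one end-vertex in $\partial\overline{\Lambda}_{r,s}$. Let $U=(U_e)_{e\in\mathcal{E}}$ be independent random variables, uniform on $[0,1]$, with law $\mathbb{P}$, and let $$C_{r,s}=\Big\{\max_{e\in A_{r,s}}U_e<\min_{e\in\mathcal{E}(\Lambda_{r,s})\setminus A_{r,s}}U_e\Big\}.$$ In the intermediate model at time $t\in[0,1]$, an edge $e$ that is none of the edges $g_{r,s}$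 is open if and only if $U_e\le t$, and the edge $g_{r,s}$ is open if and only if $U_{g_{r,s}}\le t$ and $C_{r,s}$ does not occur. Let $\widetilde P_t$ be the law of the resulting configuration of open and closed edges. Let $B(n)=[-n,n]^2\cap\mathbb{Z}^2$, let $\widetilde\theta_n(t)=\widetilde P_t(0\longleftrightarrow\partial B(n))$ be the probability that the origin is connected to $\partial B(n)$ by a path of open edges, let $\{0\longleftrightarrow\infty\}$ be the event that the open cluster of the origin is infinite, and let $$t_c^*=\sup\{t\in[0,1]:\widetilde P_t(0\longleftrightarrow\infty)=0\}.$$ Then: 1. For every $t\in[0,1]$ with $t<t_c^*$ there exists $c_t>0$ such that $\widetilde\theta_n(t)\le\exp(-c_t n)$ for all $n\ge1$. 2. There exists $c>0$ such that $\widetilde P_t(0\longleftrightarrow\infty)\ge c\,(t-t_c^*)$ for every $t\in[0,1]$ with $t>t_c^*$. -/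

import Mathlib

open MeasureTheory

noncomputable section

namespace IntermediateModel

/-- The square lattice on `ℤ × ℤ`: two vertices are adjacent when they are at `ℓ¹`-distance one. -/
def lattice : SimpleGraph (ℤ × ℤ) where
  Adj u v := |u.1 - v.1| + |u.2 - v.2| = 1
  symm := ⟨fun u v h => by rw [abs_sub_comm v.1, abs_sub_comm v.2]; exact h⟩
  loopless := ⟨fun u h => by simp at h⟩

/-- The set of (unoriented) nearest-neighbour edges of the square lattice. -/
abbrev Edge : Type := lattice.edgeSet

/-- The edges with both end-vertices in `Γ`. -/
def edgesIn (Γ : Set (ℤ × ℤ)) : Set Edge := {e | ∀ v ∈ e.1, v ∈ Γ}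

/-- The vertex boundary: vertices of `Γ` adjacent to some vertex outside `Γ`. -/
def vertexBoundary (Γ : Set (ℤ × ℤ)) : Set (ℤ × ℤ) := {v ∈ Γ | ∃ w, w ∉ Γ ∧ lattice.Adj v w}

/-- The box `B(n) = [-n, n]²` centred at the origin. -/
def box (n : ℕ) : Set (ℤ × ℤ) := Set.Icc (-(n : ℤ), -(n : ℤ)) ((n : ℤ), (n : ℤ))

/-- `Λ_{r,s}`: the translate by `(6r, 5s)` of `{0, …, 5} × {0, …, 4}`. -/
def outerBlock (r s : ℤ) : Set (ℤ × ℤ) := Set.Icc (6 * r, 5 * s) (6 * r + 5, 5 * s + 4)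

/-- `Λ̄_{r,s}`: the translate by `(6r, 5s)` of `{1, …, 4} × {1, 2, 3}`. -/
def innerBlock (r s : ℤ) : Set (ℤ × ℤ) := Set.Icc (6 * r + 1, 5 * s + 1) (6 * r + 4, 5 * s + 3)

/-- The central edge `g_{r,s}` of the block. -/
def centralEdge (r s : ℤ) : Edge :=
  ⟨s((6 * r + 2, 5 * s + 2), (6 * r + 3, 5 * s + 2)), by
    simp only [SimpleGraph.mem_edgeSet, lattice]
    norm_num⟩

/-- `A_{r,s}`: the edges of the inner block having exactly one end-vertex on its boundary. -/
def starEdges (r s : ℤ) : Set Edge :=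
  {e ∈ edgesIn (innerBlock r s) | ∃! v, v ∈ e.1 ∧ v ∈ vertexBoundary (innerBlock r s)}

/-- A clock configuration: a number of `[0, 1]` for every edge. -/
abbrev Clocks : Type := Edge → unitInterval

/-- The law of independent clocks, uniform on `[0, 1]`. -/
def clockMeasure : Measure Clocks := Measure.infinitePi fun _ : Edge => (volume : Measure unitInterval)

/-- The event `C_{r,s}`: the largest clock of `A_{r,s}` is smaller than the smallest clock of the
other edges of `Λ_{r,s}` (both edge sets are finite and non-empty). -/
def blockEvent (r s : ℤ) : Set Clocks :=
  {U | ∀ e ∈ starEdges r s, ∀ f ∈ edgesIn (outerBlock r s) \ starEdges r s, U e < U f}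

open Classical in
/-- The configuration of the intermediate model at time `t` (`true` means open): an edge is open
when its clock has rung by time `t`, and, if the edge is `g_{r,s}`, moreover `C_{r,s}` fails. -/
def config (t : ℝ) (U : Clocks) : Edge → Bool := fun e =>
  decide ((U e : ℝ) ≤ t ∧ ∀ r s : ℤ, e = centralEdge r s → U ∉ blockEvent r s)

/-- The probability that the configuration of the intermediate model at time `t` lies in `A`. -/
def prob (t : ℝ) (A : Set (Edge → Bool)) : ℝ := clockMeasure.real {U | config t U ∈ A}

/-- The graph of open edges of a configuration. -/
def openGraph (η : Edge → Bool) : SimpleGraph (ℤ × ℤ) where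
  Adj u v := ∃ h : lattice.Adj u v, η ⟨s(u, v), h⟩ = true
  symm := ⟨by
    rintro u v ⟨h, hη⟩
    refine ⟨h.symm, ?_⟩
    rw [← hη]
    congr 2
    exact Sym2.eq_swap⟩
  loopless := ⟨fun u h => lattice.loopless.irrefl u h.1⟩

/-- The open cluster of the origin. -/
def cluster (η : Edge → Bool) : Set (ℤ × ℤ) := {v | (openGraph η).Reachable (0, 0) v}

/-- The probability at time `t` that the origin is connected to `∂B(n)` by an open path. -/
def theta (n : ℕ) (t : ℝ) : ℝ := prob t {η | ∃ v ∈ vertexBoundary (box n), v ∈ cluster η}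

/-- The probability at time `t` that the open cluster of the origin is infinite. -/
def thetaInf (t : ℝ) : ℝ := prob t {η | (cluster η).Infinite}

/-- The percolation threshold of the intermediate model. -/
def criticalTime : ℝ := sSup {t ∈ Set.Icc (0 : ℝ) 1 | thetaInf t = 0}

end IntermediateModel

end

/-! Assign each edge to the cell whose block contains its lower or left end-vertex. The event
`C_{r,s}` involves the clocks of one cell only and does not depend on time. Hence the states of the
cells are independent, take finitely many values and increase with `t`: the model is a monotone
product model with cells as coordinates, and the method of Duminil-Copin, Raoufi and Tassion
applies.

`osss_inequality` bounds `θₙ (1 - θₙ)` by a sum over cells of the probability of being revealed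
times the probability of being pivotal. The algorithm explores the clusters that meet the sphere of
radius `k`. Forcing a revealed cell to be fully open turns its revelation into an arm event centred
at its corner, so averaging over `k < n` bounds the revelation probabilities by a multiple of `(∑ k
< n, θₖ) / n` (`sum_pivotal_ge`). In the other direction, `russo_lower_bound` bounds increments of
`θₙ` in time from below by the expected number of pivotal cells. It needs every increasing event of
one cell that separates the empty from the full state to gain probability at a positive rate. This
holds because a chain of states that opens the central edge first must enter the event at some step,
and `C_{r,s}` fails whenever the central clock is the smallest (`localProb_increment`). Together
these give `θₙ' ≥ c n θₙ / ∑ k < n, θₖ` on compact subintervals of `(0, 1)`, stated through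
increments with a quadratic error, so that no differentiability is needed
(`exists_theta_increment_ge`).

The rest is analysis. If the sums `∑ k < n, θₖ` are `O(√n)` at some time, integrating the inequality
twice gives exponential decay strictly before it (`exists_exp_decay`). If they are not, integrating
the logarithmic averages of the `θₖ` gives linear growth of the limit after it (`linear_le_limit`).
The second alternative cannot hold strictly below the threshold, where the limit vanishes; the first
cannot hold above it, where the sums are of order `n`. Path counting gives a threshold of at least
`1 / 8`, which keeps the interval away from `0`. -/

open MeasureTheory

noncomputable section

namespace IntermediateModel

/-! ### Expectations and influences under finite product weights -/

section ProductExpectation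

/-- The expectation of `F` when the coordinates are independent with weights `w i`. -/
def productExp {ι α : Type*} [Fintype ι] [DecidableEq ι] [Fintype α]
    (w : ι → α → ℝ) (F : (ι → α) → ℝ) : ℝ :=
  ∑ ω, (∏ i, w i (ω i)) * F ω

/-- Resampling one coordinate, as an involution of configurations with an extra state. -/
def swapCoordinate {ι α : Type*} [DecidableEq ι] (c : ι) : ((ι → α) × α) ≃ ((ι → α) × α) :=
  Function.Involutive.toPerm (fun z => (Function.update z.1 c z.2, z.1 c)) fun z => by simp

lemma prod_update_mul {ι α : Type*} [Fintype ι] [DecidableEq ι] (w : ι → α → ℝ) (c : ι)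
    (p : α → ℝ) (ω : ι → α) (x : α) :
    (∏ i, Function.update w c p i (Function.update ω c x i)) * w c (ω c) =
      (∏ i, w i (ω i)) * p x := by
  rw [← Finset.mul_prod_erase Finset.univ _ (Finset.mem_univ c),
    ← Finset.mul_prod_erase Finset.univ (fun i => w i (ω i)) (Finset.mem_univ c)]
  have : ∏ i ∈ Finset.univ.erase c, Function.update w c p i (Function.update ω c x i) =
      ∏ i ∈ Finset.univ.erase c, w i (ω i) :=
    Finset.prod_congr rfl fun i hi => by simp [Finset.ne_of_mem_erase hi]
  rw [this]
  simp only [Function.update_self]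
  ring

variable {ι α : Type*} [Fintype ι] [DecidableEq ι] [Fintype α]

/-- Adjoin an independent extra state of law `w c`. Exchanging it with coordinate `c` carries the
weights with `p` at `c` to the original weights with an extra state of law `p`. -/
lemma productExp_update (w : ι → α → ℝ) (c : ι) (p : α → ℝ) (hw : ∑ x, w c x = 1)
    (F : (ι → α) → ℝ) :
    productExp (Function.update w c p) F =
      productExp w fun ω => ∑ x, p x * F (Function.update ω c x) := by
  unfold productExp
  have h1 : ∑ ω, (∏ i, Function.update w c p i (ω i)) * F ω =
      ∑ z : (ι → α) × α, (∏ i, Function.update w c p i (z.1 i)) * w c z.2 * F z.1 := by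
    rw [Fintype.sum_prod_type]
    refine Finset.sum_congr rfl fun ω _ => ?_
    simp only [mul_right_comm _ _ (F ω), ← Finset.mul_sum, hw, mul_one]
  rw [h1, ← Equiv.sum_comp (swapCoordinate c), Fintype.sum_prod_type]
  refine Finset.sum_congr rfl fun ω _ => ?_
  rw [Finset.mul_sum]
  refine Finset.sum_congr rfl fun x _ => ?_
  change (∏ i, Function.update w c p i (Function.update ω c x i)) * w c (ω c) *
    F (Function.update ω c x) = _
  rw [prod_update_mul]
  ring

lemma productExp_resample (w : ι → α → ℝ) (c : ι) (hw : ∑ x, w c x = 1) (F : (ι → α) → ℝ) :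
    productExp w F = productExp w fun ω => ∑ x, w c x * F (Function.update ω c x) := by
  rw [← productExp_update w c (w c) hw, Function.update_eq_self]

lemma productExp_mono {w : ι → α → ℝ} (hw : ∀ i x, 0 ≤ w i x) {F G : (ι → α) → ℝ}
    (h : ∀ ω, F ω ≤ G ω) : productExp w F ≤ productExp w G :=
  Finset.sum_le_sum fun ω _ =>
    mul_le_mul_of_nonneg_left (h ω) (Finset.prod_nonneg fun i _ => hw i _)

lemma productExp_nonneg {w : ι → α → ℝ} (hw : ∀ i x, 0 ≤ w i x) {F : (ι → α) → ℝ}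
    (h : ∀ ω, 0 ≤ F ω) : 0 ≤ productExp w F :=
  Finset.sum_nonneg fun ω _ => mul_nonneg (Finset.prod_nonneg fun i _ => hw i _) (h ω)

lemma productExp_sub (w : ι → α → ℝ) (F G : (ι → α) → ℝ) :
    productExp w (fun ω => F ω - G ω) = productExp w F - productExp w G := by
  simp [productExp, mul_sub, Finset.sum_sub_distrib]

lemma productExp_const_mul (w : ι → α → ℝ) (a : ℝ) (F : (ι → α) → ℝ) :
    productExp w (fun ω => a * F ω) = a * productExp w F := by
  simp only [productExp, Finset.mul_sum]
  exact Finset.sum_congr rfl fun ω _ => by ring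

lemma productExp_sum {κ : Type*} (s : Finset κ) (w : ι → α → ℝ) (F : κ → (ι → α) → ℝ) :
    productExp w (fun ω => ∑ k ∈ s, F k ω) = ∑ k ∈ s, productExp w (F k) := by
  simp only [productExp, Finset.mul_sum]
  exact Finset.sum_comm

lemma productExp_const {w : ι → α → ℝ} (hw : ∀ i, ∑ x, w i x = 1) (a : ℝ) :
    productExp w (fun _ => a) = a := by
  have : ∑ ω : ι → α, ∏ i, w i (ω i) = 1 := by
    rw [← Fintype.prod_sum]; simp [hw]
  simp [productExp, ← Finset.sum_mul, this]

/-- The influence of the coordinate `c` on `g`. -/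
def influence (w : ι → α → ℝ) (g : (ι → α) → ℝ) (c : ι) : ℝ :=
  productExp w fun ω => ∑ x, w c x * |g ω - g (Function.update ω c x)|

/-- The average of `g` over its coordinate `c`. -/
def average {ι α : Type*} [DecidableEq ι] [Fintype α] (w : ι → α → ℝ) (c : ι)
    (g : (ι → α) → ℝ) : (ι → α) → ℝ :=
  fun ω => ∑ x, w c x * g (Function.update ω c x)

lemma influence_nonneg {w : ι → α → ℝ} (hw : ∀ i x, 0 ≤ w i x) (g : (ι → α) → ℝ) (c : ι) :
    0 ≤ influence w g c :=
  productExp_nonneg hw fun _ => Finset.sum_nonneg fun _ _ => mul_nonneg (hw _ _) (abs_nonneg _)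

/-- Updates at `c` and `d` commute, so the triangle inequality moves the absolute value inside the
average over `c`, and this average is absorbed by resampling `c`. -/
lemma influence_average_le {w : ι → α → ℝ} (hw : ∀ i x, 0 ≤ w i x) (hw1 : ∀ i, ∑ x, w i x = 1)
    (g : (ι → α) → ℝ) {c d : ι} (hcd : d ≠ c) :
    influence w (average w c g) d ≤ influence w g d := by
  unfold influence
  rw [productExp_resample w c (hw1 c)
    (fun ω => ∑ x, w d x * |g ω - g (Function.update ω d x)|)]
  refine productExp_mono hw fun ω => ?_
  calc ∑ y, w d y * |average w c g ω - average w c g (Function.update ω d y)|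
      ≤ ∑ y, w d y * ∑ x, w c x *
          |g (Function.update ω c x) - g (Function.update (Function.update ω d y) c x)| := by
        refine Finset.sum_le_sum fun y _ => mul_le_mul_of_nonneg_left ?_ (hw _ _)
        unfold average
        rw [← Finset.sum_sub_distrib]
        refine (Finset.abs_sum_le_sum_abs _ _).trans (le_of_eq ?_)
        refine Finset.sum_congr rfl fun x _ => ?_
        rw [← mul_sub, abs_mul, abs_of_nonneg (hw c x)]
    _ = ∑ x, w c x * ∑ y, w d y *
          |g (Function.update ω c x) - g (Function.update (Function.update ω c x) d y)| := by
        simp only [Finset.mul_sum]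
        rw [Finset.sum_comm]
        refine Finset.sum_congr rfl fun x _ => Finset.sum_congr rfl fun y _ => ?_
        rw [Function.update_comm hcd]
        ring

end ProductExpectation

/-! ### The OSSS inequality -/

section Exploration

/-- The configuration equal to `ω₀` on `R` and to `ω` off `R`. -/
def glue {ι α : Type*} [DecidableEq ι] (R : Finset ι) (ω₀ ω : ι → α) : ι → α :=
  fun i => if i ∈ R then ω₀ i else ω i


lemma average_update {ι α : Type*} [DecidableEq ι] [Fintype α] (w : ι → α → ℝ) (c : ι)
    (g : (ι → α) → ℝ) (ω : ι → α) (x : α) :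
    average w c g (Function.update ω c x) = average w c g ω := by
  simp [average]

lemma glue_update {ι α : Type*} [DecidableEq ι] (R : Finset ι) (ω₀ ω : ι → α) {c : ι}
    (hc : c ∉ R) (x : α) :
    glue R ω₀ (Function.update ω c x) = glue (insert c R) (Function.update ω₀ c x) ω := by
  funext i
  by_cases hi : i = c
  · subst hi; simp [glue, hc]
  · simp [glue, hi]

lemma glue_glue_left {ι α : Type*} [DecidableEq ι] (R : Finset ι) (ω₀ ω₁ ω₂ : ι → α) :
    glue R (glue R ω₀ ω₁) ω₂ = glue R ω₀ ω₂ := by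
  funext i
  by_cases hi : i ∈ R <;> simp [glue, hi]

lemma glue_mono_right {ι α : Type*} [DecidableEq ι] [Preorder α] (R : Finset ι) (ω₀ : ι → α)
    {ω₁ ω₂ : ι → α} (h : ω₁ ≤ ω₂) : glue R ω₀ ω₁ ≤ glue R ω₀ ω₂ := by
  intro i
  by_cases hi : i ∈ R
  · simp [glue, hi]
  · simpa [glue, hi] using h i

variable {ι α : Type*} [Fintype ι] [DecidableEq ι] [Fintype α]

open Classical in
/-- The probability of `A` when the coordinates are independent with weights `w i`. -/
def productProb (w : ι → α → ℝ) (A : Set (ι → α)) : ℝ :=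
  productExp w fun ω => if ω ∈ A then 1 else 0

lemma productProb_nonneg {w : ι → α → ℝ} (hw : ∀ i x, 0 ≤ w i x) (A : Set (ι → α)) :
    0 ≤ productProb w A := by
  classical
  exact productExp_nonneg hw fun ω => by split_ifs <;> norm_num

lemma productProb_resample (w : ι → α → ℝ) (c : ι) (hw : ∑ x, w c x = 1) (A : Set (ι → α)) :
    productProb w A = ∑ x, w c x * productProb w {ω | Function.update ω c x ∈ A} := by
  classical
  unfold productProb
  rw [productExp_resample w c hw, productExp_sum]
  exact Finset.sum_congr rfl fun x _ => productExp_const_mul _ _ _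

lemma productProb_mono {w : ι → α → ℝ} (hw : ∀ i x, 0 ≤ w i x) {A B : Set (ι → α)}
    (h : A ⊆ B) : productProb w A ≤ productProb w B := by
  classical
  refine productExp_mono hw fun ω => ?_
  by_cases hA : ω ∈ A
  · simp [hA, h hA]
  · simp only [hA, if_false]; split_ifs <;> norm_num

variable [Preorder α] [OrderBot α]

/-- The inductive form of the OSSS inequality: `R` is the set of coordinates already revealed, with
states given by `ω₀`, and a further coordinate is revealed when it belongs to the set `E` of the
configuration revealed so far. -/
lemma covariance_le_of_exploration {w : ι → α → ℝ} (hw : ∀ i x, 0 ≤ w i x)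
    (hw1 : ∀ i, ∑ x, w i x = 1) {f : (ι → α) → ℝ} (hf : ∀ ω, |f ω| ≤ 1)
    {E : (ι → α) → Set ι} (hE : Monotone E)
    (hfE : ∀ (R : Finset ι) (ω : ι → α), E (glue R ω ⊥) ⊆ R → f ω = f (glue R ω ⊥))
    (m : ℕ) : ∀ (R : Finset ι), Rᶜ.card = m → ∀ (ω₀ : ι → α) (g : (ι → α) → ℝ),
      productExp w (fun ω => f (glue R ω₀ ω) * g ω) -
        productExp w (fun ω => f (glue R ω₀ ω)) * productExp w g ≤
      ∑ d ∈ Rᶜ, productProb w {ω | d ∈ E (glue R ω₀ ω)} * influence w g d := by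
  induction m with
  | zero =>
    intro R hR ω₀ g
    have hR' : Rᶜ = ∅ := Finset.card_eq_zero.mp hR
    have hg : ∀ ω, glue R ω₀ ω = ω₀ := fun ω => by
      funext i
      have : i ∈ R := by
        by_contra h
        have : i ∈ Rᶜ := Finset.mem_compl.mpr h
        simp [hR'] at this
      simp [glue, this]
    simp only [hg, hR', Finset.sum_empty]
    rw [productExp_const_mul, productExp_const hw1, sub_self]
  | succ m ih =>
    intro R hR ω₀ g
    -- If the revealed states, completed by `⊥`, call for no further coordinate, then `f` is already
    -- determined and the covariance vanishes. Otherwise some unrevealed `c` is called for, and the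
    -- induction reveals it.
    by_cases hrevealed : E (glue R ω₀ ⊥) ⊆ R
    · have hc : ∀ ω, f (glue R ω₀ ω) = f (glue R ω₀ ⊥) := fun ω => by
        have := hfE R (glue R ω₀ ω)
        rw [glue_glue_left] at this
        exact this hrevealed
      simp only [hc]
      rw [productExp_const_mul, productExp_const hw1, sub_self]
      exact Finset.sum_nonneg fun d _ =>
        mul_nonneg (productProb_nonneg hw _) (influence_nonneg hw _ _)
    · obtain ⟨c, hcE, hcR⟩ := Set.not_subset.mp hrevealed
      have hcR : c ∉ R := hcR
      have hcard : (insert c R)ᶜ.card = m := by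
        rw [Finset.card_compl] at hR ⊢
        rw [Finset.card_insert_of_notMem hcR]
        omega
      set fx : α → (ι → α) → ℝ :=
        fun x ω => f (glue (insert c R) (Function.update ω₀ c x) ω) with hfx
      have h1 : productExp w (fun ω => f (glue R ω₀ ω)) =
          ∑ x, w c x * productExp w (fx x) := by
        rw [productExp_resample w c (hw1 c), productExp_sum]
        refine Finset.sum_congr rfl fun x _ => ?_
        rw [productExp_const_mul]
        simp only [glue_update _ _ _ hcR, hfx]
      have h2 : productExp w (fun ω => f (glue R ω₀ ω) * average w c g ω) =
          ∑ x, w c x * productExp w (fun ω => fx x ω * average w c g ω) := by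
        rw [productExp_resample w c (hw1 c), productExp_sum]
        refine Finset.sum_congr rfl fun x _ => ?_
        rw [productExp_const_mul]
        simp only [glue_update _ _ _ hcR, hfx, average_update]
      have h3 : productExp w g = productExp w (average w c g) :=
        productExp_resample w c (hw1 c) g
      -- Replacing `g` by its average over `c` costs at most the influence of `c`. Afterwards `g` no
      -- longer depends on `c`, so one may condition on the state of `c`.
      have h4 : productExp w (fun ω => f (glue R ω₀ ω) * g ω) -
          productExp w (fun ω => f (glue R ω₀ ω) * average w c g ω) ≤ influence w g c := by
        rw [← productExp_sub]
        refine productExp_mono hw fun ω => ?_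
        have : g ω - average w c g ω = ∑ x, w c x * (g ω - g (Function.update ω c x)) := by
          simp only [average, mul_sub, Finset.sum_sub_distrib, ← Finset.sum_mul, hw1, one_mul]
        rw [← mul_sub, this]
        refine (le_abs_self _).trans ?_
        rw [abs_mul]
        refine (mul_le_of_le_one_left (abs_nonneg _) (hf _)).trans ?_
        refine (Finset.abs_sum_le_sum_abs _ _).trans (le_of_eq ?_)
        exact Finset.sum_congr rfl fun x _ => by rw [abs_mul, abs_of_nonneg (hw c x)]
      have h5 : ∀ x, productExp w (fun ω => fx x ω * average w c g ω) -
          productExp w (fx x) * productExp w (average w c g) ≤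
          ∑ d ∈ (insert c R)ᶜ,
            productProb w {ω | d ∈ E (glue (insert c R) (Function.update ω₀ c x) ω)} *
              influence w g d := by
        intro x
        refine (ih _ hcard _ _).trans (Finset.sum_le_sum fun d hd => ?_)
        refine mul_le_mul_of_nonneg_left (influence_average_le hw hw1 g ?_)
          (productProb_nonneg hw _)
        rintro rfl
        simp at hd
      -- Since `E` is monotone, what is called for under the completion by `⊥` is called for under
      -- every completion. This pays for the whole influence of `c`.
      have h6 : productProb w {ω | c ∈ E (glue R ω₀ ω)} = 1 := by
        have : ∀ ω, c ∈ E (glue R ω₀ ω) := fun ω =>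
          hE (glue_mono_right R ω₀ (fun i => (bot_le : ⊥ ≤ ω i))) hcE
        simp only [productProb, Set.mem_ofPred_eq, this, if_true]
        exact productExp_const hw1 1
      have hins : Rᶜ = insert c (insert c R)ᶜ := by
        ext i
        by_cases hi : i = c <;> simp [hi, hcR]
      rw [hins, Finset.sum_insert (by simp), h6, one_mul]
      have h7 : ∑ d ∈ (insert c R)ᶜ, productProb w {ω | d ∈ E (glue R ω₀ ω)} * influence w g d =
          ∑ x, w c x * ∑ d ∈ (insert c R)ᶜ,
            productProb w {ω | d ∈ E (glue (insert c R) (Function.update ω₀ c x) ω)} *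
              influence w g d := by
        simp only [Finset.mul_sum]
        rw [Finset.sum_comm]
        refine Finset.sum_congr rfl fun d _ => ?_
        rw [productProb_resample w c (hw1 c), Finset.sum_mul]
        refine Finset.sum_congr rfl fun x _ => ?_
        simp only [Set.mem_ofPred_eq, glue_update _ _ _ hcR, mul_assoc]
      have h8 := Finset.sum_le_sum fun x (_ : x ∈ Finset.univ) =>
        mul_le_mul_of_nonneg_left (h5 x) (hw c x)
      rw [h7]
      simp only [mul_sub, Finset.sum_sub_distrib] at h8
      rw [← h2] at h8
      have h9 : ∑ x, w c x * (productExp w (fx x) * productExp w (average w c g)) =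
          productExp w (fun ω => f (glue R ω₀ ω)) * productExp w g := by
        rw [h1, h3, Finset.sum_mul]
        exact Finset.sum_congr rfl fun x _ => by ring
      rw [h9] at h8
      linarith

/-- The coordinate `c` is pivotal for `A`. -/
def pivotal [OrderTop α] (A : Set (ι → α)) (c : ι) : Set (ι → α) :=
  {ω | Function.update ω c ⊥ ∉ A ∧ Function.update ω c ⊤ ∈ A}

/-- The OSSS inequality for an increasing event determined by an exploration that reveals only
coordinates in a set `E` that increases with the configuration. -/
theorem osss_inequality [OrderTop α] {w : ι → α → ℝ} (hw : ∀ i x, 0 ≤ w i x)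
    (hw1 : ∀ i, ∑ x, w i x = 1) {A : Set (ι → α)} (hA : IsUpperSet A)
    {E : (ι → α) → Set ι} (hE : Monotone E)
    (hAE : ∀ (R : Finset ι) (ω : ι → α), E (glue R ω ⊥) ⊆ R → ω ∈ A → glue R ω ⊥ ∈ A) :
    productProb w A * (1 - productProb w A) ≤
      ∑ d, productProb w {ω | d ∈ E ω} * productProb w (pivotal A d) := by
  classical
  set f : (ι → α) → ℝ := fun ω => if ω ∈ A then 1 else 0 with hf
  -- With nothing revealed and `g = f`, the covariance is the variance of the indicator of `A`.
  have h := covariance_le_of_exploration hw hw1 (f := f)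
    (fun ω => by simp only [hf]; split_ifs <;> norm_num) hE (fun R ω hR => ?_) _ ∅ rfl ⊥ f
  · have hglue : ∀ ω : ι → α, glue ∅ ⊥ ω = ω := fun ω => by funext i; simp [glue]
    have hsq : ∀ ω, f ω * f ω = f ω := fun ω => by simp only [hf]; split_ifs <;> norm_num
    simp only [hglue, hsq, Finset.compl_empty] at h
    have hle : ∀ d, influence w f d ≤ productProb w (pivotal A d) := fun d => by
      refine productExp_mono hw fun ω => ?_
      by_cases hp : ω ∈ pivotal A d
      · simp only [hp, if_true]
        calc ∑ x, w d x * |f ω - f (Function.update ω d x)| ≤ ∑ x, w d x * 1 := by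
              refine Finset.sum_le_sum fun x _ => mul_le_mul_of_nonneg_left ?_ (hw _ _)
              simp only [hf]; split_ifs <;> norm_num
          _ = 1 := by simp [hw1]
      · simp only [hp, if_false]
        refine (Finset.sum_eq_zero fun x _ => ?_).le
        have hlow : Function.update ω d ⊥ ≤ ω := fun i => by
          by_cases hi : i = d
          · subst hi; simp
          · simp [hi]
        have hlow' : Function.update ω d ⊥ ≤ Function.update ω d x := fun i => by
          by_cases hi : i = d
          · subst hi; simp
          · simp [hi]
        have hup : ω ≤ Function.update ω d ⊤ := fun i => by
          by_cases hi : i = d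
          · subst hi; simp
          · simp [hi]
        have hup' : Function.update ω d x ≤ Function.update ω d ⊤ := fun i => by
          by_cases hi : i = d
          · subst hi; simp
          · simp [hi]
        by_cases hb : Function.update ω d ⊥ ∈ A
        · simp [hf, hA hlow hb, hA hlow' hb]
        · have ht : Function.update ω d ⊤ ∉ A := fun ht => hp ⟨hb, ht⟩
          have h₁ : ω ∉ A := fun h => ht (hA hup h)
          have h₂ : Function.update ω d x ∉ A := fun h => ht (hA hup' h)
          simp [hf, h₁, h₂]
    calc productProb w A * (1 - productProb w A)
        = productExp w f - productExp w f * productExp w f := by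
          simp only [productProb, hf]; ring
      _ ≤ _ := h
      _ ≤ _ := Finset.sum_le_sum fun d _ =>
        mul_le_mul_of_nonneg_left (hle d) (productProb_nonneg hw _)
  · by_cases hω : ω ∈ A
    · simp [hf, hω, hAE R ω hR hω]
    · have : glue R ω ⊥ ∉ A := fun h' => hω (hA (fun i => by
        by_cases hi : i ∈ R <;> simp [glue, hi]) h')
      simp [hf, hω, this]

end Exploration

/-! ### A Russo-type lower bound for increments -/

section Russo

variable {ι α : Type*} [Fintype ι] [DecidableEq ι] [Fintype α]

lemma productProb_update (w : ι → α → ℝ) (c : ι) (p : α → ℝ) (hw : ∑ x, w c x = 1)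
    (A : Set (ι → α)) :
    productProb (Function.update w c p) A =
      ∑ x, p x * productProb w {ω | Function.update ω c x ∈ A} := by
  classical
  unfold productProb
  rw [productExp_update w c p hw, productExp_sum]
  exact Finset.sum_congr rfl fun x _ => productExp_const_mul _ _ _

lemma productProb_le_one {w : ι → α → ℝ} (hw : ∀ i x, 0 ≤ w i x) (hw1 : ∀ i, ∑ x, w i x = 1)
    (A : Set (ι → α)) : productProb w A ≤ 1 := by
  classical
  rw [← productExp_const hw1 1]
  exact productExp_mono hw fun ω => by split_ifs <;> norm_num

/-- The weights that are `q` on `S` and `p` off `S`. -/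
def mixedWeights {ι α : Type*} [DecidableEq ι] (p q : α → ℝ) (S : Finset ι) : ι → α → ℝ :=
  fun i => if i ∈ S then q else p

lemma mixedWeights_insert {ι α : Type*} [DecidableEq ι] (p q : α → ℝ) (S : Finset ι) (c : ι) :
    mixedWeights p q (insert c S) = Function.update (mixedWeights p q S) c q := by
  funext i
  by_cases hi : i = c
  · subst hi; simp [mixedWeights]
  · simp [mixedWeights, hi]

lemma mixedWeights_nonneg {ι α : Type*} [DecidableEq ι] {p q : α → ℝ} (hp : ∀ x, 0 ≤ p x)
    (hq : ∀ x, 0 ≤ q x) (S : Finset ι) (i : ι) (x : α) : 0 ≤ mixedWeights p q S i x := by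
  unfold mixedWeights; split_ifs <;> simp [hp, hq]

lemma sum_mixedWeights {ι α : Type*} [DecidableEq ι] [Fintype α] {p q : α → ℝ}
    (hp : ∑ x, p x = 1) (hq : ∑ x, q x = 1) (S : Finset ι) (i : ι) :
    ∑ x, mixedWeights p q S i x = 1 := by
  unfold mixedWeights; split_ifs <;> simp [hp, hq]

variable {p q : α → ℝ}

/-- Changing the law of one coordinate moves any probability by at most the `ℓ¹` distance of the two
laws; the coordinates of `S` are changed one at a time. -/
lemma productProb_mixedWeights_ge (hp : ∀ x, 0 ≤ p x) (hq : ∀ x, 0 ≤ q x)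
    (hp1 : ∑ x, p x = 1) (hq1 : ∑ x, q x = 1) {δ : ℝ} (hδ : ∑ x, |q x - p x| ≤ δ)
    (A : Set (ι → α)) (S : Finset ι) :
    productProb (fun _ => p) A - S.card * δ ≤ productProb (mixedWeights p q S) A := by
  induction S using Finset.induction_on with
  | empty =>
    have : mixedWeights p q (∅ : Finset ι) = fun _ => p := by funext i; simp [mixedWeights]
    simp [this]
  | insert c S hc ih =>
    have hw := mixedWeights_nonneg (ι := ι) hp hq S
    have hw1 := sum_mixedWeights (ι := ι) hp1 hq1 S
    rw [mixedWeights_insert, productProb_update _ _ _ (hw1 c), Finset.card_insert_of_notMem hc]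
    have h0 := productProb_resample (mixedWeights p q S) c (hw1 c) A
    have hpc : mixedWeights p q S c = p := by simp [mixedWeights, hc]
    rw [hpc] at h0
    set w := mixedWeights p q S
    have h1 : ∑ x, p x * productProb w {ω | Function.update ω c x ∈ A} -
        ∑ x, q x * productProb w {ω | Function.update ω c x ∈ A} ≤ δ := by
      rw [← Finset.sum_sub_distrib]
      refine (Finset.sum_le_sum fun x _ => ?_).trans hδ
      rw [← sub_mul, abs_sub_comm]
      calc (p x - q x) * productProb w {ω | Function.update ω c x ∈ A}
          ≤ |p x - q x| * productProb w {ω | Function.update ω c x ∈ A} :=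
            mul_le_mul_of_nonneg_right (le_abs_self _) (productProb_nonneg hw _)
        _ ≤ |p x - q x| := mul_le_of_le_one_right (abs_nonneg _) (productProb_le_one hw hw1 _)
    push_cast
    linarith

variable [Preorder α] [OrderBot α] [OrderTop α]

open Classical in
/-- A lower bound of Russo type: if replacing the weights `p` of a single coordinate by `q`
increases the probability of every increasing non-trivial event by `η` at least, then replacing all
of them increases the probability of `A` by `η` times the expected number of pivotal coordinates,
up to an error of second order. -/
theorem russo_lower_bound (hp : ∀ x, 0 ≤ p x) (hq : ∀ x, 0 ≤ q x)
    (hp1 : ∑ x, p x = 1) (hq1 : ∑ x, q x = 1) {δ η : ℝ} (hδ : ∑ x, |q x - p x| ≤ δ)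
    (hη : 0 ≤ η)
    (hmono : ∀ B : Set α, IsUpperSet B → 0 ≤ ∑ x, (q x - p x) * (if x ∈ B then 1 else 0))
    (hpiv : ∀ B : Set α, IsUpperSet B → ⊥ ∉ B → ⊤ ∈ B →
      η ≤ ∑ x, (q x - p x) * (if x ∈ B then 1 else 0))
    {A : Set (ι → α)} (hA : IsUpperSet A) :
    η * ∑ c, productProb (fun _ => p) (pivotal A c) - Fintype.card ι ^ 2 * (η * δ) ≤
      productProb (fun _ => q) A - productProb (fun _ => p) A := by
  have hδ0 : 0 ≤ δ := (Finset.sum_nonneg fun _ _ => abs_nonneg _).trans hδ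
  -- The laws are replaced one coordinate at a time. Each replacement gains `η` times a pivotal
  -- probability under mixed weights, and returning to the weights `p` costs at most `card ι * δ`.
  have key : ∀ S : Finset ι,
      ∑ c ∈ S, η * (productProb (fun _ => p) (pivotal A c) - Fintype.card ι * δ) ≤
        productProb (mixedWeights p q S) A - productProb (fun _ => p) A := by
    intro S
    induction S using Finset.induction_on with
    | empty =>
      have : mixedWeights p q (∅ : Finset ι) = fun _ => p := by funext i; simp [mixedWeights]
      simp [this]
    | insert c S hc ih =>
      rw [Finset.sum_insert hc]
      have hw := mixedWeights_nonneg (ι := ι) hp hq S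
      have hw1 := sum_mixedWeights (ι := ι) hp1 hq1 S
      have hge := productProb_mixedWeights_ge hp hq hp1 hq1 hδ (pivotal A c) S
      rw [mixedWeights_insert, productProb_update _ _ _ (hw1 c)]
      have h0 := productProb_resample (mixedWeights p q S) c (hw1 c) A
      have hpc : mixedWeights p q S c = p := by simp [mixedWeights, hc]
      rw [hpc] at h0
      set w := mixedWeights p q S
      have h1 : η * productProb w (pivotal A c) ≤
          ∑ x, q x * productProb w {ω | Function.update ω c x ∈ A} -
            ∑ x, p x * productProb w {ω | Function.update ω c x ∈ A} := by
        rw [← Finset.sum_sub_distrib]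
        simp only [← sub_mul]
        unfold productProb
        simp only [← productExp_const_mul]
        rw [← productExp_sum]
        refine productExp_mono hw fun ω => ?_
        have hB : IsUpperSet {x | Function.update ω c x ∈ A} := fun x y hxy hx =>
          hA (update_le_update_iff.mpr ⟨hxy, fun _ _ => le_rfl⟩) hx
        by_cases hp' : ω ∈ pivotal A c
        · simp only [hp', if_true, mul_one]
          exact hpiv _ hB hp'.1 hp'.2
        · simp only [hp', if_false, mul_zero]
          exact hmono _ hB
      have h2 : (S.card : ℝ) ≤ Fintype.card ι := by exact_mod_cast Finset.card_le_univ S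
      have h3 : productProb (fun _ => p) (pivotal A c) - Fintype.card ι * δ ≤
          productProb w (pivotal A c) := by nlinarith
      have h4 := mul_le_mul_of_nonneg_left h3 hη
      linarith
  have h := key Finset.univ
  have : mixedWeights p q (Finset.univ : Finset ι) = fun _ => q := by
    funext i; simp [mixedWeights]
  rw [this, ← Finset.mul_sum, Finset.sum_sub_distrib] at h
  simp only [Finset.sum_const, Finset.card_univ, nsmul_eq_mul] at h
  linarith

end Russo

/-! ### The partition of the edges into cells -/

section Geometry

lemma lattice_adj_iff (u v : ℤ × ℤ) : lattice.Adj u v ↔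
    (u.1 = v.1 ∧ (u.2 = v.2 + 1 ∨ v.2 = u.2 + 1)) ∨
      (u.2 = v.2 ∧ (u.1 = v.1 + 1 ∨ v.1 = u.1 + 1)) := by
  change |u.1 - v.1| + |u.2 - v.2| = 1 ↔ _
  rw [Int.abs_eq_natAbs, Int.abs_eq_natAbs]
  omega

/-- The labels of the edges of a cell: the position in the block of the lower or left end-vertex,
and `true` for a horizontal edge. -/
abbrev Label : Type := Fin 6 × Fin 5 × Bool

/-- The lower or left end-vertex of the edge of the cell `c` with label `l`. -/
def tail (c : ℤ × ℤ) (l : Label) : ℤ × ℤ := (6 * c.1 + (l.1 : ℕ), 5 * c.2 + (l.2.1 : ℕ))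

/-- The upper or right end-vertex of the edge of the cell `c` with label `l`. -/
def head (c : ℤ × ℤ) (l : Label) : ℤ × ℤ :=
  if l.2.2 then ((tail c l).1 + 1, (tail c l).2) else ((tail c l).1, (tail c l).2 + 1)

lemma adj_tail_head (c : ℤ × ℤ) (l : Label) : lattice.Adj (tail c l) (head c l) := by
  rw [lattice_adj_iff]
  unfold head
  split_ifs <;> simp

/-- The edge of the cell `c` with label `l`. -/
def edgeOf (c : ℤ × ℤ) (l : Label) : Edge := ⟨s(tail c l, head c l), adj_tail_head c l⟩

lemma edgeOf_injective : Function.Injective fun z : (ℤ × ℤ) × Label => edgeOf z.1 z.2 := by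
  rintro ⟨⟨r, s⟩, ⟨i, j, b⟩⟩ ⟨⟨r', s'⟩, ⟨i', j', b'⟩⟩ h
  have h' : s(tail (r, s) (i, j, b), head (r, s) (i, j, b)) =
      s(tail (r', s') (i', j', b'), head (r', s') (i', j', b')) := congrArg Subtype.val h
  have hi := i.2; have hi' := i'.2; have hj := j.2; have hj' := j'.2
  simp only [Prod.mk.injEq, Fin.ext_iff]
  rw [Sym2.eq_iff] at h'
  cases b <;> cases b' <;> simp [tail, head] at h' ⊢ <;> omega

lemma exists_edgeOf (e : Edge) : ∃ c l, edgeOf c l = e := by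
  obtain ⟨e, he⟩ := e
  induction e using Sym2.ind with
  | _ u v =>
    -- Euclidean division by `6` and `5` recovers the cell and the position in its block.
    have key : ∀ (x : ℤ × ℤ) (b : Bool), ∃ c l, tail c l = x ∧ l.2.2 = b := fun x b =>
      ⟨(x.1 / 6, x.2 / 5), (⟨(x.1 % 6).toNat, by omega⟩, ⟨(x.2 % 5).toNat, by omega⟩, b), by
        refine ⟨Prod.ext ?_ ?_, rfl⟩ <;> simp only [tail] <;> omega⟩
    have hadj := (lattice_adj_iff u v).mp he
    rcases hadj with ⟨h1, h2 | h2⟩ | ⟨h1, h2 | h2⟩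
    · obtain ⟨c, l, h, hb⟩ := key v false
      refine ⟨c, l, Subtype.ext ?_⟩
      have : head c l = u := by simp [head, hb, h, Prod.ext_iff, h1, h2]
      simp [edgeOf, this, h, Sym2.eq_swap]
    · obtain ⟨c, l, h, hb⟩ := key u false
      refine ⟨c, l, Subtype.ext ?_⟩
      have : head c l = v := by simp [head, hb, h, Prod.ext_iff, h1, h2]
      simp [edgeOf, this, h]
    · obtain ⟨c, l, h, hb⟩ := key v true
      refine ⟨c, l, Subtype.ext ?_⟩
      have : head c l = u := by simp [head, hb, h, Prod.ext_iff, h1, h2]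
      simp [edgeOf, this, h, Sym2.eq_swap]
    · obtain ⟨c, l, h, hb⟩ := key u true
      refine ⟨c, l, Subtype.ext ?_⟩
      have : head c l = v := by simp [head, hb, h, Prod.ext_iff, h1, h2]
      simp [edgeOf, this, h]

/-- Every edge belongs to exactly one cell. -/
def cellEquiv : ((ℤ × ℤ) × Label) ≃ Edge :=
  Equiv.ofBijective (fun z => edgeOf z.1 z.2)
    ⟨edgeOf_injective, fun e => let ⟨c, l, h⟩ := exists_edgeOf e; ⟨(c, l), h⟩⟩

@[simp] lemma cellEquiv_apply (z : (ℤ × ℤ) × Label) : cellEquiv z = edgeOf z.1 z.2 := rfl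

lemma cellEquiv_symm_edgeOf (c : ℤ × ℤ) (l : Label) : cellEquiv.symm (edgeOf c l) = (c, l) := by
  rw [Equiv.symm_apply_eq]; rfl

/-- The label of the central edge of the block. -/
def centralLabel : Label := (2, 2, true)

lemma edgeOf_eq_centralEdge_iff (c : ℤ × ℤ) (l : Label) (r s : ℤ) :
    edgeOf c l = centralEdge r s ↔ c = (r, s) ∧ l = centralLabel := by
  have : centralEdge r s = edgeOf (r, s) centralLabel := by
    refine Subtype.ext ?_
    simp [centralEdge, edgeOf, tail, head, centralLabel, add_assoc]
  rw [this]
  constructor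
  · intro h
    simpa using @edgeOf_injective (c, l) ((r, s), centralLabel) h
  · rintro ⟨rfl, rfl⟩; rfl

lemma edgeOf_mem_edgesIn (c : ℤ × ℤ) (l : Label) (Γ : Set (ℤ × ℤ)) :
    edgeOf c l ∈ edgesIn Γ ↔ tail c l ∈ Γ ∧ head c l ∈ Γ := by
  change (∀ v ∈ s(tail c l, head c l), v ∈ Γ) ↔ _
  simp only [Sym2.mem_iff, forall_eq_or_imp, forall_eq]

lemma mem_vertexBoundary_innerBlock (r s : ℤ) (v : ℤ × ℤ) :
    v ∈ vertexBoundary (innerBlock r s) ↔ v ∈ innerBlock r s ∧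
      (v.1 = 6 * r + 1 ∨ v.1 = 6 * r + 4 ∨ v.2 = 5 * s + 1 ∨ v.2 = 5 * s + 3) := by
  obtain ⟨x, y⟩ := v
  constructor
  · rintro ⟨hv, ⟨a, b⟩, hw, hadj⟩
    refine ⟨hv, ?_⟩
    rw [lattice_adj_iff] at hadj
    simp only [innerBlock, Set.mem_Icc, Prod.mk_le_mk] at hv hw hadj ⊢
    omega
  · rintro ⟨hv, h⟩
    refine ⟨hv, ?_⟩
    simp only at h
    rcases h with h | h | h | h
    · refine ⟨(x - 1, y), ?_, by rw [lattice_adj_iff]; simp⟩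
      simp only [innerBlock, Set.mem_Icc, Prod.mk_le_mk] at hv ⊢; omega
    · refine ⟨(x + 1, y), ?_, by rw [lattice_adj_iff]; simp⟩
      simp only [innerBlock, Set.mem_Icc, Prod.mk_le_mk] at hv ⊢; omega
    · refine ⟨(x, y - 1), ?_, by rw [lattice_adj_iff]; simp⟩
      simp only [innerBlock, Set.mem_Icc, Prod.mk_le_mk] at hv ⊢; omega
    · refine ⟨(x, y + 1), ?_, by rw [lattice_adj_iff]; simp⟩
      simp only [innerBlock, Set.mem_Icc, Prod.mk_le_mk] at hv ⊢; omega

lemma edgeOf_mem_starEdges_iff (c : ℤ × ℤ) (l : Label) (r s : ℤ) :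
    edgeOf c l ∈ starEdges r s ↔ (tail c l ∈ innerBlock r s ∧ head c l ∈ innerBlock r s) ∧
      ((tail c l ∈ vertexBoundary (innerBlock r s) ∧ head c l ∉ vertexBoundary (innerBlock r s)) ∨
      (tail c l ∉ vertexBoundary (innerBlock r s) ∧
        head c l ∈ vertexBoundary (innerBlock r s))) := by
  change edgeOf c l ∈ edgesIn _ ∧ (∃! v, v ∈ s(tail c l, head c l) ∧ _) ↔ _
  rw [edgeOf_mem_edgesIn]
  refine and_congr_right fun _ => ?_
  have hne := (adj_tail_head c l).ne
  constructor
  · rintro ⟨v, ⟨hv, hb⟩, huniq⟩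
    rcases Sym2.mem_iff.mp hv with rfl | rfl
    · exact Or.inl ⟨hb, fun h => hne (huniq _ ⟨Sym2.mem_mk_right _ _, h⟩).symm⟩
    · exact Or.inr ⟨fun h => hne (huniq _ ⟨Sym2.mem_mk_left _ _, h⟩), hb⟩
  · rintro (⟨h1, h2⟩ | ⟨h1, h2⟩)
    · refine ⟨_, ⟨Sym2.mem_mk_left _ _, h1⟩, ?_⟩
      rintro w ⟨hw, hb⟩
      rcases Sym2.mem_iff.mp hw with rfl | rfl
      · rfl
      · exact absurd hb h2
    · refine ⟨_, ⟨Sym2.mem_mk_right _ _, h2⟩, ?_⟩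
      rintro w ⟨hw, hb⟩
      rcases Sym2.mem_iff.mp hw with rfl | rfl
      · exact absurd hb h1
      · rfl

/-- The labels of the edges of `A_{r,s}`. -/
def starLabels : Set Label := {l | edgeOf (0, 0) l ∈ starEdges 0 0}

/-- The labels of the edges with both ends in the block. -/
def blockLabels : Set Label := {l | edgeOf (0, 0) l ∈ edgesIn (outerBlock 0 0)}

lemma edgeOf_mem_starEdges (r s : ℤ) (l : Label) :
    edgeOf (r, s) l ∈ starEdges r s ↔ l ∈ starLabels := by
  obtain ⟨i, j, b⟩ := l
  simp only [starLabels, Set.mem_ofPred_eq, edgeOf_mem_starEdges_iff,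
    mem_vertexBoundary_innerBlock]
  cases b <;> simp only [innerBlock, tail, head, Set.mem_Icc, Prod.mk_le_mk, if_true,
    Bool.false_eq_true, if_false] <;> omega

lemma edgeOf_mem_edgesIn_outerBlock (r s : ℤ) (l : Label) :
    edgeOf (r, s) l ∈ edgesIn (outerBlock r s) ↔ l ∈ blockLabels := by
  obtain ⟨i, j, b⟩ := l
  simp only [blockLabels, Set.mem_ofPred_eq, edgeOf_mem_edgesIn]
  cases b <;> simp only [outerBlock, tail, head, Set.mem_Icc, Prod.mk_le_mk, if_true,
    Bool.false_eq_true, if_false] <;> omega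

lemma exists_label_of_mem_edgesIn (r s : ℤ) {e : Edge} (he : e ∈ edgesIn (outerBlock r s)) :
    ∃ l, edgeOf (r, s) l = e := by
  obtain ⟨⟨r', s'⟩, ⟨i, j, b⟩, rfl⟩ := exists_edgeOf e
  rw [edgeOf_mem_edgesIn] at he
  have h := he.1
  have hi := i.2; have hj := j.2
  simp only [outerBlock, tail, Set.mem_Icc, Prod.mk_le_mk] at h
  obtain rfl : r' = r := by omega
  obtain rfl : s' = s := by omega
  exact ⟨_, rfl⟩

lemma starEdges_subset (r s : ℤ) : starEdges r s ⊆ edgesIn (outerBlock r s) := by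
  rintro e ⟨he, -⟩ v hv
  have := he v hv
  simp only [innerBlock, outerBlock, Set.mem_Icc, Prod.le_def] at this ⊢
  omega

lemma centralLabel_mem : centralLabel ∈ blockLabels \ starLabels := by
  refine ⟨?_, fun h => ?_⟩
  · rw [← edgeOf_mem_edgesIn_outerBlock 0 0, edgeOf_mem_edgesIn]
    simp [tail, head, centralLabel, outerBlock]
  · rw [← edgeOf_mem_starEdges 0 0, edgeOf_mem_starEdges_iff] at h
    simp only [mem_vertexBoundary_innerBlock] at h
    simp [tail, head, centralLabel, innerBlock] at h

lemma starLabels_nonempty : starLabels.Nonempty := by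
  refine ⟨(1, 2, true), ?_⟩
  rw [← edgeOf_mem_starEdges 0 0, edgeOf_mem_starEdges_iff]
  simp only [mem_vertexBoundary_innerBlock]
  simp [tail, head, innerBlock]

end Geometry

/-! ### Independence of the cells -/

section LocalModel

/-- The event `C_{r,s}` in terms of the clocks of a cell. -/
def localEvent : Set (Label → unitInterval) :=
  {u | ∀ a ∈ starLabels, ∀ b ∈ blockLabels \ starLabels, u a < u b}

/-- The clocks of the cell `c`. -/
def cellClocks (U : Clocks) (c : ℤ × ℤ) : Label → unitInterval := fun l => U (edgeOf c l)

lemma mem_blockEvent_iff (r s : ℤ) (U : Clocks) :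
    U ∈ blockEvent r s ↔ cellClocks U (r, s) ∈ localEvent := by
  constructor
  · intro h a ha b hb
    refine h _ ((edgeOf_mem_starEdges r s a).mpr ha) _
      ⟨(edgeOf_mem_edgesIn_outerBlock r s b).mpr hb.1, fun h' => hb.2 ?_⟩
    exact (edgeOf_mem_starEdges r s b).mp h'
  · intro h e he f hf
    obtain ⟨a, rfl⟩ := exists_label_of_mem_edgesIn r s (starEdges_subset r s he)
    obtain ⟨b, rfl⟩ := exists_label_of_mem_edgesIn r s hf.1
    exact h a ((edgeOf_mem_starEdges r s a).mp he) b
      ⟨(edgeOf_mem_edgesIn_outerBlock r s b).mp hf.1,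
        fun h' => hf.2 ((edgeOf_mem_starEdges r s b).mpr h')⟩

open Classical in
/-- The configuration of a cell at time `t` in terms of its clocks. -/
def localConfig (t : ℝ) (u : Label → unitInterval) : Label → Bool := fun l =>
  decide ((u l : ℝ) ≤ t ∧ (l = centralLabel → u ∉ localEvent))

/-- This locality is what makes the model a product over cells: the only dependence between edges,
through `C_{r,s}`, stays inside one cell. -/
lemma config_edgeOf (t : ℝ) (U : Clocks) (c : ℤ × ℤ) (l : Label) :
    config t U (edgeOf c l) = localConfig t (cellClocks U c) l := by
  unfold config localConfig
  congr 1
  simp only [edgeOf_eq_centralEdge_iff, mem_blockEvent_iff, cellClocks, eq_iff_iff]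
  refine and_congr_right fun _ => ⟨fun h hl => h c.1 c.2 ⟨rfl, hl⟩, ?_⟩
  rintro h r s ⟨rfl, hl⟩
  exact h hl

/-- The law of the clocks of a cell. -/
def cellMeasure : Measure (Label → unitInterval) := Measure.pi fun _ => volume

instance : IsProbabilityMeasure cellMeasure := by unfold cellMeasure; infer_instance

instance : IsProbabilityMeasure clockMeasure := by unfold clockMeasure; infer_instance

lemma measurable_cellClocks : Measurable cellClocks := by
  unfold cellClocks; fun_prop

/-- The clocks are relabelled by cell and label and then curried; an i.i.d. family stays i.i.d. when
grouped into blocks. -/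
lemma map_cellClocks :
    clockMeasure.map cellClocks = Measure.infinitePi fun _ : ℤ × ℤ => cellMeasure := by
  have h1 := Measure.map_infinitePi_infinitePi_of_inj
    (P := fun _ : Edge => (volume : Measure unitInterval)) cellEquiv.injective
  have h2 := Measure.infinitePi_map_curry
    (fun (_ : ℤ × ℤ) (_ : Label) => (volume : Measure unitInterval))
  rw [← h1, Measure.map_map (by fun_prop) (by fun_prop)] at h2
  have h3 : (fun _ : ℤ × ℤ => cellMeasure) =
      fun _ : ℤ × ℤ => Measure.infinitePi fun _ : Label => (volume : Measure unitInterval) := by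
    funext _
    rw [Measure.infinitePi_eq_pi]; rfl
  rw [h3, ← h2]
  rfl

lemma measurableSet_localEvent : MeasurableSet localEvent := by
  have : localEvent = ⋂ a ∈ starLabels, ⋂ b ∈ blockLabels \ starLabels, {u | u a < u b} := by
    ext; simp only [localEvent, Set.mem_ofPred_eq, Set.mem_iInter]
  rw [this]
  refine MeasurableSet.biInter (Set.to_countable _) fun a _ =>
    MeasurableSet.biInter (Set.to_countable _) fun b _ => ?_
  exact measurableSet_lt (measurable_pi_apply a) (measurable_pi_apply b)

lemma measurable_localConfig (t : ℝ) : Measurable (localConfig t) := by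
  refine measurable_pi_lambda _ fun l => measurable_to_bool ?_
  have : (fun u => localConfig t u l) ⁻¹' {true} =
      {u | (u l : ℝ) ≤ t} ∩ {u | l = centralLabel → u ∉ localEvent} := by
    ext u; simp [localConfig]
  rw [this]
  refine MeasurableSet.inter (measurableSet_le (by fun_prop) (by fun_prop)) ?_
  by_cases hl : l = centralLabel
  · simp only [hl, forall_const]
    exact measurableSet_localEvent.compl
  · simp [hl]

/-- The probability that a cell is in the state `x` at time `t`. -/
def stateWeight (t : ℝ) (x : Label → Bool) : ℝ := cellMeasure.real {u | localConfig t u = x}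

lemma measurableSet_localConfig_mem (t : ℝ) (B : Set (Label → Bool)) :
    MeasurableSet {u | localConfig t u ∈ B} :=
  measurable_localConfig t (Set.toFinite B).measurableSet

lemma stateWeight_nonneg (t : ℝ) (x : Label → Bool) : 0 ≤ stateWeight t x := measureReal_nonneg

open Classical in
lemma sum_stateWeight_mul (t : ℝ) (B : Set (Label → Bool)) :
    ∑ x, stateWeight t x * (if x ∈ B then 1 else 0) =
      cellMeasure.real {u | localConfig t u ∈ B} := by
  have h : {u | localConfig t u ∈ B} =
      ⋃ x ∈ Finset.univ.filter (· ∈ B), {u | localConfig t u = x} := by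
    ext u; simp
  rw [h, measureReal_biUnion_finset (h := fun _ _ => measure_ne_top _ _)]
  · simp [stateWeight, Finset.sum_filter]
  · intro x _ y _ hxy
    refine Set.disjoint_left.mpr fun u hu hu' => hxy ?_
    exact (show localConfig t u = x from hu).symm.trans hu'
  · exact fun x _ => measurableSet_localConfig_mem t {x}

lemma sum_stateWeight (t : ℝ) : ∑ x, stateWeight t x = 1 := by
  classical
  simpa using sum_stateWeight_mul t Set.univ

/-- The states of the cells of a finite window. -/
def windowState (K : Finset (ℤ × ℤ)) (t : ℝ) (U : Clocks) : K → (Label → Bool) :=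
  fun c => localConfig t (cellClocks U c)

lemma measurable_windowState (K : Finset (ℤ × ℤ)) (t : ℝ) : Measurable (windowState K t) :=
  measurable_pi_lambda _ fun c => (measurable_localConfig t).comp
    ((measurable_pi_apply (c : ℤ × ℤ)).comp measurable_cellClocks)

lemma measurableSet_windowState_mem (K : Finset (ℤ × ℤ)) (t : ℝ)
    (A : Set (K → (Label → Bool))) : MeasurableSet {U | windowState K t U ∈ A} :=
  measurable_windowState K t (Set.toFinite A).measurableSet

lemma measure_windowState_eq (K : Finset (ℤ × ℤ)) (t : ℝ) (ω : K → (Label → Bool)) :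
    clockMeasure.real {U | windowState K t U = ω} = ∏ c, stateWeight t (ω c) := by
  classical
  set T : ℤ × ℤ → Set (Label → unitInterval) :=
    fun c => if h : c ∈ K then {u | localConfig t u = ω ⟨c, h⟩} else Set.univ with hT
  have hTm : ∀ c, MeasurableSet (T c) := fun c => by
    simp only [hT]; split_ifs with h
    · exact measurableSet_localConfig_mem t {ω ⟨c, h⟩}
    · exact MeasurableSet.univ
  have h1 : {U | windowState K t U = ω} = cellClocks ⁻¹' (Set.pi K T) := by
    ext U
    simp only [Set.mem_ofPred_eq, Set.mem_preimage, Set.mem_pi, funext_iff (f := windowState K t U),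
      Subtype.forall, hT]
    refine forall_congr' fun c => forall_congr' fun hc => ?_
    have hc' : c ∈ K := hc
    simp [hc', windowState]
  rw [h1, measureReal_def, ← Measure.map_apply measurable_cellClocks
    (MeasurableSet.pi (Set.to_countable _) fun c _ => hTm c), map_cellClocks,
    Measure.infinitePi_pi _ fun c _ => hTm c, ENNReal.toReal_prod, ← Finset.prod_coe_sort]
  refine Finset.prod_congr rfl fun c _ => ?_
  simp [hT, stateWeight, measureReal_def]

lemma productProb_stateWeight (K : Finset (ℤ × ℤ)) (t : ℝ) (A : Set (K → (Label → Bool))) :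
    productProb (fun _ => stateWeight t) A = clockMeasure.real {U | windowState K t U ∈ A} := by
  classical
  have h : {U | windowState K t U ∈ A} =
      ⋃ x ∈ Finset.univ.filter (· ∈ A), {U | windowState K t U = x} := by
    ext u; simp
  rw [h, measureReal_biUnion_finset (h := fun _ _ => measure_ne_top _ _)]
  · simp [productProb, productExp, Finset.sum_filter, measure_windowState_eq]
  · intro x _ y _ hxy
    refine Set.disjoint_left.mpr fun u hu hu' => hxy ?_
    exact (show windowState K t u = x from hu).symm.trans hu'
  · exact fun x _ => measurableSet_windowState_mem K t {x}

end LocalModel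

/-! ### Estimates for a single cell -/

section LocalBounds

lemma localConfig_eq_true (t : ℝ) (u : Label → unitInterval) (l : Label) :
    localConfig t u l = true ↔ (u l : ℝ) ≤ t ∧ (l = centralLabel → u ∉ localEvent) := by
  simp [localConfig]

/-- The event `C_{r,s}` compares clocks without reference to time, so the central edge, once open,
stays open. -/
lemma localConfig_mono {s t : ℝ} (hst : s ≤ t) (u : Label → unitInterval) :
    localConfig s u ≤ localConfig t u := fun l => by
  rw [Bool.le_iff_imp, localConfig_eq_true, localConfig_eq_true]
  exact fun h => ⟨h.1.trans hst, h.2⟩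

lemma volume_real_unitInterval_Ioc {s t : ℝ} (hs : 0 ≤ s) (hst : s ≤ t) (ht : t ≤ 1) :
    (volume : Measure unitInterval).real {x | s < (x : ℝ) ∧ (x : ℝ) ≤ t} = t - s := by
  have : {x : unitInterval | s < (x : ℝ) ∧ (x : ℝ) ≤ t} =
      Set.Ioc ⟨s, hs, hst.trans ht⟩ ⟨t, hs.trans hst, ht⟩ := by
    ext x; simp [← Subtype.coe_lt_coe, ← Subtype.coe_le_coe]
  rw [this, measureReal_def, unitInterval.volume_Ioc,
    ENNReal.toReal_ofReal (by simpa using hst)]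

lemma volume_real_unitInterval_Iic {t : ℝ} (h0 : 0 ≤ t) (ht : t ≤ 1) :
    (volume : Measure unitInterval).real {x | (x : ℝ) ≤ t} = t := by
  have : {x : unitInterval | (x : ℝ) ≤ t} = Set.Iic ⟨t, h0, ht⟩ := by
    ext x; simp [← Subtype.coe_le_coe]
  rw [this, measureReal_def, unitInterval.volume_Iic, ENNReal.toReal_ofReal (by simpa using h0)]

lemma volume_real_unitInterval_Ioi {t : ℝ} (h0 : 0 ≤ t) (ht : t ≤ 1) :
    (volume : Measure unitInterval).real {x | t < (x : ℝ)} = 1 - t := by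
  have : {x : unitInterval | t < (x : ℝ)} = Set.Ioi ⟨t, h0, ht⟩ := by
    ext x; simp [← Subtype.coe_lt_coe]
  rw [this, measureReal_def, unitInterval.volume_Ioi, ENNReal.toReal_ofReal (by simpa using ht)]

lemma cellMeasure_real_pi (J : Label → Set unitInterval) :
    cellMeasure.real (Set.pi Set.univ J) = ∏ l, (volume : Measure unitInterval).real (J l) := by
  rw [cellMeasure, measureReal_def, Measure.pi_pi, ENNReal.toReal_prod]
  rfl

/-- The clocks for which the edges of `D` ring before time `s`, the central edge first among them,
the edge `e` rings between `s` and `t`, and the others ring after time `t`. -/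
def clockBox (a s t : ℝ) (D : Finset Label) (e : Label) : Label → Set unitInterval := fun l =>
  if l = e then {x | s < (x : ℝ) ∧ (x : ℝ) ≤ t}
  else if l ∈ D then
    if l = centralLabel then {x | (x : ℝ) ≤ a} else {x | a < (x : ℝ) ∧ (x : ℝ) ≤ s}
  else {x | t < (x : ℝ)}

/-- The factor of `e` is exactly `t - s`. Every other factor is one of `a`, `s - a` and `1 - t`,
each at least `m`. -/
lemma le_cellMeasure_clockBox {a s t m : ℝ} (hm : 0 ≤ m) (hma : m ≤ a) (has : 2 * a ≤ s)
    (hst : s ≤ t) (ht : m ≤ 1 - t) (D : Finset Label) (e : Label) :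
    (t - s) * m ^ (Fintype.card Label - 1) ≤
      cellMeasure.real (Set.pi Set.univ (clockBox a s t D e)) := by
  have ha0 : 0 ≤ a := hm.trans hma
  rw [cellMeasure_real_pi]
  calc (t - s) * m ^ (Fintype.card Label - 1) = ∏ l : Label, if l = e then t - s else m := by
        rw [← Finset.mul_prod_erase _ _ (Finset.mem_univ e), if_pos rfl]
        congr 1
        rw [Finset.prod_congr rfl (g := fun _ => m)
          fun l hl => if_neg (Finset.ne_of_mem_erase hl), Finset.prod_const,
          Finset.card_erase_of_mem (Finset.mem_univ e), Finset.card_univ]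
    _ ≤ _ := by
        refine Finset.prod_le_prod (fun l _ => ?_) fun l _ => ?_
        · split_ifs <;> linarith
        · unfold clockBox
          split_ifs
          · rw [volume_real_unitInterval_Ioc (by linarith) hst (by linarith)]
          · rw [volume_real_unitInterval_Iic (by linarith) (by linarith)]; exact hma
          · rw [volume_real_unitInterval_Ioc (by linarith) (by linarith) (by linarith)]; linarith
          · rw [volume_real_unitInterval_Ioi (by linarith) (by linarith)]; exact ht

/-- The central edge is itself one of the edges that, under `C_{r,s}`, must ring after all edges of
the nonempty set `A_{r,s}`. -/
lemma notMem_localEvent_of_central_lt {u : Label → unitInterval}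
    (h : ∀ l ≠ centralLabel, u centralLabel < u l) : u ∉ localEvent := fun hu => by
  obtain ⟨l, hl⟩ := starLabels_nonempty
  have hne : l ≠ centralLabel := by
    rintro rfl; exact centralLabel_mem.2 hl
  exact lt_asymm (h l hne) (hu l hl _ centralLabel_mem)

/-- In both cases allowed by `hD` the central clock is the smallest of the cell, so `C_{r,s}` fails
and an edge is open exactly when its clock has rung. Between the two times only `e` changes. -/
lemma localConfig_of_mem_clockBox {a s t : ℝ} (has : a ≤ s)
    {D : Finset Label} {e : Label} (he : e ∉ D)
    (hD : (D = ∅ ∧ e = centralLabel) ∨ centralLabel ∈ D) {u : Label → unitInterval}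
    (hu : u ∈ Set.pi Set.univ (clockBox a s t D e)) :
    localConfig s u = (fun l => decide (l ∈ D)) ∧
      localConfig t u = (fun l => decide (l ∈ insert e D)) := by
  have hue : s < (u e : ℝ) ∧ (u e : ℝ) ≤ t := by
    simpa [clockBox] using hu e (Set.mem_univ _)
  have huD : ∀ l ∈ D, l ≠ centralLabel → a < (u l : ℝ) ∧ (u l : ℝ) ≤ s := fun l hl hne => by
    have hle : l ≠ e := fun h => he (h ▸ hl)
    simpa [clockBox, hle, hl, hne] using hu l (Set.mem_univ _)
  have hug : centralLabel ∈ D → (u centralLabel : ℝ) ≤ a := fun hl => by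
    have hle : centralLabel ≠ e := fun h => he (h ▸ hl)
    simpa [clockBox, hle, hl] using hu centralLabel (Set.mem_univ _)
  have huo : ∀ l ∉ D, l ≠ e → t < (u l : ℝ) := fun l hl hle => by
    simpa [clockBox, hle, hl] using hu l (Set.mem_univ _)
  have hC : u ∉ localEvent := notMem_localEvent_of_central_lt fun l hl => by
    rw [← Subtype.coe_lt_coe]
    rcases hD with ⟨rfl, rfl⟩ | hg
    · exact hue.2.trans_lt (huo l (by simp) hl)
    · have := hug hg
      by_cases hle : l = e
      · subst hle; linarith [hue.1]
      · by_cases hlD : l ∈ D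
        · linarith [(huD l hlD hl).1]
        · linarith [huo l hlD hle]
  constructor <;> funext l <;>
    rw [Bool.eq_iff_iff, localConfig_eq_true, decide_eq_true_iff, and_iff_left fun _ => hC]
  · constructor
    · intro h
      by_contra hl
      by_cases hle : l = e
      · subst hle; linarith [hue.1]
      · linarith [huo l hl hle]
    · intro hl
      by_cases hlg : l = centralLabel
      · subst hlg; linarith [hug hl]
      · exact (huD l hl hlg).2
  · rw [Finset.mem_insert]
    constructor
    · intro h
      by_contra! hl
      linarith [huo l hl.2 hl.1]
    · rintro (rfl | hl)
      · exact hue.2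
      · by_cases hlg : l = centralLabel
        · subst hlg; linarith [hug hl]
        · linarith [(huD l hl hlg).2]

/-- Open the central edge first, then the other edges one by one. The chain leads from the empty to
the full state, so one of its steps enters `B`. -/
lemma exists_pivotal_label {B : Set (Label → Bool)} (h0 : ⊥ ∉ B) (h1 : ⊤ ∈ B) :
    ∃ (D : Finset Label) (e : Label), e ∉ D ∧ ((D = ∅ ∧ e = centralLabel) ∨ centralLabel ∈ D) ∧
      (fun l => decide (l ∈ D)) ∉ B ∧ (fun l => decide (l ∈ insert e D)) ∈ B := by
  by_cases hg : (fun l => decide (l ∈ insert centralLabel (∅ : Finset Label))) ∈ B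
  · refine ⟨∅, centralLabel, by simp, Or.inl ⟨rfl, rfl⟩, ?_, hg⟩
    convert h0
    simp only [Finset.notMem_empty, decide_false]
    rfl
  · have key : ∀ S : Finset Label, (fun l => decide (l ∈ insert centralLabel S)) ∈ B →
        ∃ (D : Finset Label) (e : Label), e ∉ D ∧
          ((D = ∅ ∧ e = centralLabel) ∨ centralLabel ∈ D) ∧
          (fun l => decide (l ∈ D)) ∉ B ∧ (fun l => decide (l ∈ insert e D)) ∈ B := by
      intro S
      induction S using Finset.induction_on with
      | empty => exact fun h => absurd h hg
      | insert e S he ih =>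
        intro h
        by_cases hS : (fun l => decide (l ∈ insert centralLabel S)) ∈ B
        · exact ih hS
        · rw [Finset.insert_comm] at h
          refine ⟨insert centralLabel S, e, fun heS => ?_, Or.inr (Finset.mem_insert_self _ _),
            hS, h⟩
          rw [Finset.insert_eq_of_mem heS] at h
          exact hS h
    refine key Finset.univ ?_
    convert h1
    simp only [Finset.mem_univ, Finset.mem_insert, or_true, decide_true]
    rfl

open Classical in
lemma sum_stateWeight_sub_mul (s t : ℝ) (B : Set (Label → Bool)) :
    ∑ x, (stateWeight t x - stateWeight s x) * (if x ∈ B then 1 else 0) =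
      cellMeasure.real {u | localConfig t u ∈ B} - cellMeasure.real {u | localConfig s u ∈ B} := by
  simp only [sub_mul, Finset.sum_sub_distrib, sum_stateWeight_mul]

lemma localProb_mono {s t : ℝ} (hst : s ≤ t) {B : Set (Label → Bool)} (hB : IsUpperSet B) :
    cellMeasure.real {u | localConfig s u ∈ B} ≤ cellMeasure.real {u | localConfig t u ∈ B} :=
  measureReal_mono fun u hu => hB (localConfig_mono hst u) hu

lemma localProb_increment {a s t m : ℝ} (hm : 0 ≤ m) (hma : m ≤ a) (has : 2 * a ≤ s)
    (hst : s ≤ t) (ht : m ≤ 1 - t) {B : Set (Label → Bool)} (hB : IsUpperSet B)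
    (h0 : ⊥ ∉ B) (h1 : ⊤ ∈ B) :
    (t - s) * m ^ (Fintype.card Label - 1) ≤
      cellMeasure.real {u | localConfig t u ∈ B} - cellMeasure.real {u | localConfig s u ∈ B} := by
  obtain ⟨D, e, he, hD, hDB, heB⟩ := exists_pivotal_label h0 h1
  have hsub : {u | localConfig s u ∈ B} ⊆ {u | localConfig t u ∈ B} :=
    fun u hu => hB (localConfig_mono hst u) hu
  rw [← measureReal_sdiff hsub (measurableSet_localConfig_mem s B)]
  refine (le_cellMeasure_clockBox hm hma has hst ht D e).trans (measureReal_mono fun u hu => ?_)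
  obtain ⟨hs', ht'⟩ := localConfig_of_mem_clockBox (by linarith) he hD hu
  exact ⟨by rw [Set.mem_ofPred_eq, ht']; exact heB, fun h => hDB (by
    rw [Set.mem_ofPred_eq, hs'] at h; exact h)⟩

/-- Both laws are read off the same clocks, and the states can differ only if some clock of the cell
lies in `(s, t]`. A union bound over labels controls that event, which each of the two laws
contributes once. -/
lemma sum_abs_stateWeight_sub_le {s t : ℝ} (hs : 0 ≤ s) (hst : s ≤ t) (ht : t ≤ 1) :
    ∑ x, |stateWeight t x - stateWeight s x| ≤ 2 * (Fintype.card Label * (t - s)) := by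
  classical
  set X : Set (Label → unitInterval) := {u | localConfig t u ≠ localConfig s u} with hX
  have hXm : MeasurableSet X :=
    (measurableSet_eq_fun (measurable_localConfig t) (measurable_localConfig s)).compl
  have hXle : cellMeasure.real X ≤ Fintype.card Label * (t - s) := by
    have hsub : X ⊆ ⋃ l ∈ (Finset.univ : Finset Label),
        {u : Label → unitInterval | s < (u l : ℝ) ∧ (u l : ℝ) ≤ t} := by
      intro u hu
      by_contra h
      simp only [Finset.mem_univ, Set.iUnion_true, Set.mem_iUnion, Set.mem_ofPred_eq, not_exists,
        not_and, not_le] at h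
      refine hu (le_antisymm (fun l => ?_) (localConfig_mono hst u))
      rw [Bool.le_iff_imp, localConfig_eq_true, localConfig_eq_true]
      rintro ⟨h1, h2⟩
      exact ⟨not_lt.mp fun h' => absurd h1 (not_le.mpr (h l h')), h2⟩
    refine (measureReal_mono hsub (measure_ne_top _ _)).trans
      ((measureReal_biUnion_finset_le _ _).trans ?_)
    refine (Finset.sum_le_card_nsmul _ _ (t - s) fun l _ => ?_).trans_eq (by simp)
    have hmp : MeasurePreserving (Function.eval l) cellMeasure volume :=
      measurePreserving_eval (fun _ : Label => (volume : Measure unitInterval)) l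
    have hm : MeasurableSet {x : unitInterval | s < (x : ℝ) ∧ (x : ℝ) ≤ t} :=
      (measurableSet_lt measurable_const measurable_subtype_coe).inter
        (measurableSet_le measurable_subtype_coe measurable_const)
    have := hmp.measureReal_preimage hm.nullMeasurableSet
    rw [volume_real_unitInterval_Ioc hs hst ht] at this
    exact this.le
  have hsum : ∀ r : ℝ, ∑ x, cellMeasure.real ({u | localConfig r u = x} ∩ X) =
      cellMeasure.real X := fun r => by
    rw [← measureReal_biUnion_finset (h := fun _ _ => measure_ne_top _ _)]
    · congr 1
      ext u; simp
    · intro x _ y _ hxy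
      refine Set.disjoint_left.mpr fun u hu hu' => hxy ?_
      exact (show localConfig r u = x from hu.1).symm.trans hu'.1
    · exact fun x _ => (measurableSet_localConfig_mem r {x}).inter hXm
  have hx : ∀ x, |stateWeight t x - stateWeight s x| ≤
      cellMeasure.real ({u | localConfig t u = x} ∩ X) +
        cellMeasure.real ({u | localConfig s u = x} ∩ X) := fun x => by
    have h1 : stateWeight t x = cellMeasure.real ({u | localConfig t u = x} ∩ X) +
        cellMeasure.real ({u | localConfig t u = x} \ X) :=
      (measureReal_inter_add_sdiff hXm).symm
    have h2 : stateWeight s x = cellMeasure.real ({u | localConfig s u = x} ∩ X) +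
        cellMeasure.real ({u | localConfig s u = x} \ X) :=
      (measureReal_inter_add_sdiff hXm).symm
    have h3 : ({u | localConfig t u = x} \ X : Set _) = {u | localConfig s u = x} \ X := by
      ext u
      simp only [hX, Set.mem_sdiff, Set.mem_ofPred_eq, not_not]
      constructor
      · rintro ⟨h, h'⟩; exact ⟨h' ▸ h, h'⟩
      · rintro ⟨h, h'⟩; exact ⟨h'.trans h, h'⟩
    rw [h1, h2, h3, add_sub_add_right_eq_sub]
    exact (abs_sub _ _).trans_eq (by
      rw [abs_of_nonneg measureReal_nonneg, abs_of_nonneg measureReal_nonneg])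
  calc ∑ x, |stateWeight t x - stateWeight s x| ≤ _ := Finset.sum_le_sum fun x _ => hx x
    _ = 2 * cellMeasure.real X := by rw [Finset.sum_add_distrib, hsum, hsum]; ring
    _ ≤ _ := by linarith

/-- The central clock is put below `a` and the others between `a` and `s`, which excludes `C_{r,s}`.
-/
lemma le_stateWeight_top {a s : ℝ} (ha : 0 ≤ a) (has : 2 * a ≤ s) (hs : s ≤ 1) :
    a ^ Fintype.card Label ≤ stateWeight s ⊤ := by
  have h : a ^ Fintype.card Label ≤ cellMeasure.real (Set.pi Set.univ fun l : Label =>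
      if l = centralLabel then {x : unitInterval | (x : ℝ) ≤ a}
      else {x | a < (x : ℝ) ∧ (x : ℝ) ≤ s}) := by
    rw [cellMeasure_real_pi, ← Finset.card_univ, ← Finset.prod_const]
    refine Finset.prod_le_prod (fun _ _ => ha) fun l _ => ?_
    split_ifs
    · rw [volume_real_unitInterval_Iic ha (by linarith)]
    · rw [volume_real_unitInterval_Ioc ha (by linarith) hs]; linarith
  refine h.trans (measureReal_mono fun u hu => ?_)
  have hug : (u centralLabel : ℝ) ≤ a := by simpa using hu centralLabel (Set.mem_univ _)
  have hul : ∀ l ≠ centralLabel, a < (u l : ℝ) ∧ (u l : ℝ) ≤ s := fun l hl => by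
    simpa [hl] using hu l (Set.mem_univ _)
  have hC : u ∉ localEvent := notMem_localEvent_of_central_lt fun l hl => by
    rw [← Subtype.coe_lt_coe]; linarith [(hul l hl).1]
  funext l
  change localConfig s u l = true
  rw [localConfig_eq_true, and_iff_left fun _ => hC]
  by_cases hl : l = centralLabel
  · subst hl; linarith
  · exact (hul l hl).2

lemma le_stateWeight_bot {s : ℝ} (h0 : 0 ≤ s) (hs : s ≤ 1) :
    (1 - s) ^ Fintype.card Label ≤ stateWeight s ⊥ := by
  have h : (1 - s) ^ Fintype.card Label = cellMeasure.real (Set.pi Set.univ fun _ : Label =>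
      {x : unitInterval | s < (x : ℝ)}) := by
    rw [cellMeasure_real_pi, ← Finset.card_univ, ← Finset.prod_const]
    exact Finset.prod_congr rfl fun l _ => (volume_real_unitInterval_Ioi h0 hs).symm
  rw [h]
  refine measureReal_mono fun u hu => ?_
  funext l
  change localConfig s u l = false
  rw [Bool.eq_false_iff, Ne, localConfig_eq_true]
  exact fun h' => absurd h'.1 (not_le.mpr (hu l (Set.mem_univ _)))

end LocalBounds

/-! ### Connections to spheres -/

section Connectivity

/-- The sup norm on the lattice. -/
def supNorm (v : ℤ × ℤ) : ℕ := max v.1.natAbs v.2.natAbs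

lemma mem_box_iff (n : ℕ) (v : ℤ × ℤ) : v ∈ box n ↔ supNorm v ≤ n := by
  simp only [box, supNorm, Set.mem_Icc, Prod.le_def]
  omega

lemma supNorm_sub_le_of_adj {u v : ℤ × ℤ} (h : lattice.Adj u v) (w : ℤ × ℤ) :
    supNorm (v - w) ≤ supNorm (u - w) + 1 := by
  rw [lattice_adj_iff] at h
  simp only [supNorm, Prod.fst_sub, Prod.snd_sub]
  omega

lemma mem_vertexBoundary_box (n : ℕ) (v : ℤ × ℤ) :
    v ∈ vertexBoundary (box n) ↔ supNorm v = n := by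
  constructor
  · rintro ⟨hv, w, hw, hadj⟩
    rw [mem_box_iff] at hv hw
    have := supNorm_sub_le_of_adj hadj 0
    simp only [sub_zero] at this
    omega
  · obtain ⟨x, y⟩ := v
    intro h
    refine ⟨(mem_box_iff _ _).mpr h.le, ?_⟩
    simp only [mem_box_iff, supNorm] at h ⊢
    by_cases hx : x.natAbs = n
    · by_cases h0 : 0 ≤ x
      · exact ⟨(x + 1, y), by simp only; omega, by rw [lattice_adj_iff]; simp⟩
      · exact ⟨(x - 1, y), by simp only; omega, by rw [lattice_adj_iff]; simp⟩
    · by_cases h0 : 0 ≤ y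
      · exact ⟨(x, y + 1), by simp only; omega, by rw [lattice_adj_iff]; simp⟩
      · exact ⟨(x, y - 1), by simp only; omega, by rw [lattice_adj_iff]; simp⟩

lemma openGraph_le_lattice (η : Edge → Bool) : openGraph η ≤ lattice := fun _ _ h => h.1

lemma openGraph_mono {η η' : Edge → Bool} (h : η ≤ η') : openGraph η ≤ openGraph η' := by
  rintro u v ⟨huv, ho⟩
  exact ⟨huv, Bool.le_iff_imp.mp (h _) ho⟩

/-- A discrete intermediate value argument: the distance to `w` increases by at most one along an
edge. -/
lemma exists_reachable_supNorm_eq {η : Edge → Bool} {u v : ℤ × ℤ}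
    (h : (openGraph η).Reachable u v) (w : ℤ × ℤ) {k : ℕ} (hu : supNorm (u - w) ≤ k)
    (hv : k ≤ supNorm (v - w)) :
    ∃ z, supNorm (z - w) = k ∧ (openGraph η).Reachable u z := by
  rw [SimpleGraph.reachable_iff_reflTransGen] at h
  induction h with
  | refl => exact ⟨u, le_antisymm hu hv, SimpleGraph.Reachable.refl _⟩
  | @tail b c hb hbc ih =>
    by_cases hk : k ≤ supNorm (b - w)
    · exact ih hk
    · have := supNorm_sub_le_of_adj (openGraph_le_lattice η hbc) w
      refine ⟨c, by omega, ?_⟩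
      rw [SimpleGraph.reachable_iff_reflTransGen]
      exact hb.tail hbc

/-- The vertex `x` is connected to the sphere of radius `k` around `w`. -/
def ConnectedToSphere (η : Edge → Bool) (x w : ℤ × ℤ) (k : ℕ) : Prop :=
  ∃ z, supNorm (z - w) = k ∧ (openGraph η).Reachable x z

lemma ConnectedToSphere.mono {η η' : Edge → Bool} (h : η ≤ η') {x w : ℤ × ℤ} {k : ℕ}
    (hc : ConnectedToSphere η x w k) : ConnectedToSphere η' x w k :=
  let ⟨z, hz, hr⟩ := hc
  ⟨z, hz, hr.mono (openGraph_mono h)⟩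

lemma ConnectedToSphere.anti {η : Edge → Bool} {x : ℤ × ℤ} {k m : ℕ} (hkm : k ≤ m)
    (h : ConnectedToSphere η x x m) : ConnectedToSphere η x x k := by
  obtain ⟨z, hz, hr⟩ := h
  exact exists_reachable_supNorm_eq hr x (by simp [supNorm]) (hz ▸ hkm)

lemma theta_eq (n : ℕ) (t : ℝ) :
    theta n t = clockMeasure.real {U | ConnectedToSphere (config t U) 0 0 n} := by
  unfold theta prob ConnectedToSphere
  simp only [mem_vertexBoundary_box, cluster, Set.mem_ofPred_eq, sub_zero]
  rfl

/-- Whether the origin is connected to `∂B(n)` depends only on the edges of `B(n)`. -/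
lemma ConnectedToSphere.of_eqOn {η η' : Edge → Bool} {n : ℕ}
    (hη : ∀ e ∈ edgesIn (box n), η e = true → η' e = true)
    (h : ConnectedToSphere η 0 0 n) : ConnectedToSphere η' 0 0 n := by
  obtain ⟨z, hz, hr⟩ := h
  have key : ∀ u, (openGraph η).Reachable u z → supNorm u ≤ n → ConnectedToSphere η' u 0 n := by
    intro u hu
    rw [SimpleGraph.reachable_iff_reflTransGen] at hu
    induction hu using Relation.ReflTransGen.head_induction_on with
    | refl => exact fun _ => ⟨z, hz, SimpleGraph.Reachable.refl _⟩
    | @head a c hac _ ih =>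
      intro ha
      by_cases han : supNorm a = n
      · exact ⟨a, by simpa using han, SimpleGraph.Reachable.refl _⟩
      · have hc : supNorm c ≤ n := by
          have := supNorm_sub_le_of_adj hac.1 0
          simp only [sub_zero] at this
          omega
        obtain ⟨y, hy, hcy⟩ := ih hc
        refine ⟨y, hy, SimpleGraph.Reachable.trans (SimpleGraph.Adj.reachable ?_) hcy⟩
        obtain ⟨hl, ho⟩ := hac
        refine ⟨hl, hη _ ?_ ho⟩
        intro v hv
        rcases Sym2.mem_iff.mp hv with rfl | rfl
        · exact (mem_box_iff _ _).mpr ha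
        · exact (mem_box_iff _ _).mpr hc
  exact key 0 hr (by simp [supNorm])

end Connectivity

/-! ### One-arm events as events of finitely many cells -/

section Window

/-- The configuration with the given states of the cells of `K`, closed elsewhere. -/
def extend (K : Finset (ℤ × ℤ)) (ω : K → (Label → Bool)) : Edge → Bool := fun e =>
  if h : (cellEquiv.symm e).1 ∈ K then ω ⟨_, h⟩ (cellEquiv.symm e).2 else false

lemma extend_edgeOf (K : Finset (ℤ × ℤ)) (ω : K → (Label → Bool)) (c : ℤ × ℤ) (l : Label) :
    extend K ω (edgeOf c l) = if h : c ∈ K then ω ⟨c, h⟩ l else false := by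
  unfold extend
  simp only [cellEquiv_symm_edgeOf]

lemma extend_mono (K : Finset (ℤ × ℤ)) : Monotone (extend K) := by
  intro ω ω' h e
  unfold extend
  split_ifs
  · exact h _ _
  · exact le_rfl

lemma extend_windowState_le (K : Finset (ℤ × ℤ)) (t : ℝ) (U : Clocks) :
    extend K (windowState K t U) ≤ config t U := by
  intro e
  obtain ⟨c, l, rfl⟩ := exists_edgeOf e
  rw [extend_edgeOf, config_edgeOf]
  split_ifs
  · exact le_rfl
  · exact Bool.false_le _

/-- A finite set of cells that contain all edges of `B(n)`. -/
def boxWindow (n : ℕ) : Finset (ℤ × ℤ) := Finset.Icc (-(n : ℤ) - 1, -(n : ℤ) - 1) (n, n)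

lemma mem_boxWindow_of_edgeOf {n : ℕ} {c : ℤ × ℤ} {l : Label}
    (h : edgeOf c l ∈ edgesIn (box n)) : c ∈ boxWindow n := by
  rw [edgeOf_mem_edgesIn] at h
  have h1 := h.1
  have hi := l.1.2; have hj := l.2.1.2
  simp only [box, tail, Set.mem_Icc, Prod.le_def] at h1
  simp only [boxWindow, Finset.mem_Icc, Prod.le_def]
  omega

/-- The event that the origin is connected to `∂B(n)`, in terms of the states of the cells. -/
def armEvent (n : ℕ) : Set (boxWindow n → (Label → Bool)) :=
  {ω | ConnectedToSphere (extend (boxWindow n) ω) 0 0 n}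

lemma isUpperSet_armEvent (n : ℕ) : IsUpperSet (armEvent n) :=
  fun _ _ h hω => ConnectedToSphere.mono (extend_mono _ h) hω

lemma windowState_mem_armEvent_iff (n : ℕ) (t : ℝ) (U : Clocks) :
    windowState (boxWindow n) t U ∈ armEvent n ↔ ConnectedToSphere (config t U) 0 0 n := by
  refine ⟨fun h => ConnectedToSphere.mono (extend_windowState_le _ t U) h, fun h => ?_⟩
  refine ConnectedToSphere.of_eqOn (fun e he ho => ?_) h
  obtain ⟨c, l, rfl⟩ := exists_edgeOf e
  have hc := mem_boxWindow_of_edgeOf he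
  rw [config_edgeOf] at ho
  rw [extend_edgeOf, dif_pos hc]
  exact ho

lemma setOf_connectedToSphere_eq (n : ℕ) (t : ℝ) :
    {U | ConnectedToSphere (config t U) 0 0 n} =
      {U | windowState (boxWindow n) t U ∈ armEvent n} := by
  ext U; exact (windowState_mem_armEvent_iff n t U).symm

lemma measurableSet_connectedToSphere (n : ℕ) (t : ℝ) :
    MeasurableSet {U | ConnectedToSphere (config t U) 0 0 n} := by
  rw [setOf_connectedToSphere_eq]
  exact measurableSet_windowState_mem _ _ _

lemma theta_eq_productProb (n : ℕ) (t : ℝ) :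
    theta n t = productProb (fun _ => stateWeight t) (armEvent n) := by
  rw [theta_eq, productProb_stateWeight, setOf_connectedToSphere_eq]

lemma theta_nonneg (n : ℕ) (t : ℝ) : 0 ≤ theta n t := by
  rw [theta_eq]; exact measureReal_nonneg

lemma theta_antitone (t : ℝ) : Antitone fun n => theta n t := fun m n hmn => by
  simp only [theta_eq]
  exact measureReal_mono fun U h => ConnectedToSphere.anti hmn h

lemma config_mono {s t : ℝ} (hst : s ≤ t) (U : Clocks) : config s U ≤ config t U := fun e => by
  obtain ⟨c, l, rfl⟩ := exists_edgeOf e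
  rw [config_edgeOf, config_edgeOf]
  exact localConfig_mono hst _ l

lemma theta_mono (n : ℕ) : Monotone (theta n) := fun s t hst => by
  simp only [theta_eq]
  exact measureReal_mono fun U h => ConnectedToSphere.mono (config_mono hst U) h

lemma theta_zero (t : ℝ) : theta 0 t = 1 := by
  rw [theta_eq]
  have : {U | ConnectedToSphere (config t U) 0 0 0} = Set.univ :=
    Set.eq_univ_of_forall fun U => ⟨0, by simp [supNorm], SimpleGraph.Reachable.refl _⟩
  rw [this]
  simp

end Window

/-! ### Invariance under translations by cells -/

section Translation

/-- The lower left corner of the block of the cell `c`. -/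
def corner (c : ℤ × ℤ) : ℤ × ℤ := (6 * c.1, 5 * c.2)

/-- The translation of edges by the corner of `c`. -/
def shiftEdge (c : ℤ × ℤ) (e : Edge) : Edge :=
  cellEquiv ((cellEquiv.symm e).1 + c, (cellEquiv.symm e).2)

lemma shiftEdge_edgeOf (c c' : ℤ × ℤ) (l : Label) :
    shiftEdge c (edgeOf c' l) = edgeOf (c' + c) l := by
  simp [shiftEdge, cellEquiv_symm_edgeOf]

lemma shiftEdge_injective (c : ℤ × ℤ) : Function.Injective (shiftEdge c) := by
  intro e e' h
  have := cellEquiv.injective h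
  simp only [Prod.mk.injEq, add_left_inj] at this
  exact cellEquiv.symm.injective (Prod.ext this.1 this.2)

lemma tail_add (c c' : ℤ × ℤ) (l : Label) : tail (c' + c) l = tail c' l + corner c := by
  simp only [tail, corner, Prod.fst_add, Prod.snd_add, Prod.mk_add_mk]
  ext <;> simp only <;> ring

lemma head_add (c c' : ℤ × ℤ) (l : Label) : head (c' + c) l = head c' l + corner c := by
  unfold head
  rw [tail_add]
  split_ifs <;> ext <;> simp only [Prod.fst_add, Prod.snd_add] <;> ring

lemma shiftEdge_val (c : ℤ × ℤ) (e : Edge) : (shiftEdge c e).1 = e.1.map (· + corner c) := by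
  obtain ⟨c', l, rfl⟩ := exists_edgeOf e
  rw [shiftEdge_edgeOf]
  simp [edgeOf, tail_add, head_add]

lemma config_comp_shiftEdge (c : ℤ × ℤ) (t : ℝ) (U : Clocks) :
    config t (U ∘ shiftEdge c) = config t U ∘ shiftEdge c := by
  funext e
  obtain ⟨c', l, rfl⟩ := exists_edgeOf e
  rw [Function.comp_apply, shiftEdge_edgeOf, config_edgeOf, config_edgeOf]
  congr 1
  funext l
  simp [cellClocks, shiftEdge_edgeOf]

lemma ConnectedToSphere.shift {η : Edge → Bool} {c : ℤ × ℤ} {k : ℕ}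
    (h : ConnectedToSphere η (corner c) (corner c) k) :
    ConnectedToSphere (η ∘ shiftEdge c) 0 0 k := by
  obtain ⟨z, hz, hr⟩ := h
  let φ : openGraph η →g openGraph (η ∘ shiftEdge c) :=
    { toFun := fun v => v - corner c
      map_rel' := by
        rintro u v ⟨huv, ho⟩
        have hadj : lattice.Adj (u - corner c) (v - corner c) := by
          change |u.1 - (corner c).1 - (v.1 - (corner c).1)| +
            |u.2 - (corner c).2 - (v.2 - (corner c).2)| = 1
          rw [sub_sub_sub_cancel_right, sub_sub_sub_cancel_right]
          exact huv
        refine ⟨hadj, ?_⟩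
        rw [Function.comp_apply, ← ho]
        congr 1
        refine Subtype.ext ?_
        rw [shiftEdge_val]
        simp }
  refine ⟨z - corner c, by simpa using hz, ?_⟩
  have := hr.map φ
  simpa [φ] using this

lemma measurePreserving_shift (c : ℤ × ℤ) :
    MeasurePreserving (fun U : Clocks => U ∘ shiftEdge c) clockMeasure clockMeasure := by
  refine ⟨by unfold Function.comp; fun_prop, ?_⟩
  exact Measure.map_infinitePi_infinitePi_of_inj
    (P := fun _ : Edge => (volume : Measure unitInterval)) (shiftEdge_injective c)

/-- The model is shown invariant only under translations preserving the blocks, which is why arms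
are centred at corners of cells. -/
lemma measure_connectedToSphere_corner_le (c : ℤ × ℤ) (k : ℕ) (t : ℝ) :
    clockMeasure.real {U | ConnectedToSphere (config t U) (corner c) (corner c) k} ≤
      theta k t := by
  rw [theta_eq, ← (measurePreserving_shift c).measureReal_preimage
    (measurableSet_connectedToSphere k t).nullMeasurableSet]
  refine measureReal_mono fun U hU => ?_
  change ConnectedToSphere (config t (U ∘ shiftEdge c)) 0 0 k
  rw [config_comp_shiftEdge]
  exact ConnectedToSphere.shift hU

end Translation

/-! ### Exploration from spheres and the differential inequality -/

section Exploration

lemma mul_productProb_update_le {ι α : Type*} [Fintype ι] [DecidableEq ι] [Fintype α]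
    {w : ι → α → ℝ} (hw : ∀ i x, 0 ≤ w i x) (c : ι) (hw1 : ∑ x, w c x = 1) (x : α)
    (A : Set (ι → α)) :
    w c x * productProb w {ω | Function.update ω c x ∈ A} ≤ productProb w A := by
  rw [productProb_resample w c hw1 A]
  exact Finset.single_le_sum
    (f := fun x => w c x * productProb w {ω | Function.update ω c x ∈ A})
    (fun x _ => mul_nonneg (hw c x) (productProb_nonneg hw _)) (Finset.mem_univ x)

/-- The cells of the window having an edge with an end-vertex connected to the sphere of radius `k`
around the origin. -/
def reachedCells (K : Finset (ℤ × ℤ)) (k : ℕ) (ω : K → (Label → Bool)) : Set K :=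
  {c | ∃ l v, (v = tail c l ∨ v = head c l) ∧ ConnectedToSphere (extend K ω) v 0 k}

lemma reachedCells_mono (K : Finset (ℤ × ℤ)) (k : ℕ) : Monotone (reachedCells K k) := by
  rintro ω ω' h c ⟨l, v, hv, hc⟩
  exact ⟨l, v, hv, hc.mono (extend_mono K h)⟩

/-- Follow the path from the sphere. The current vertex is already connected to the sphere within
the revealed configuration, so the cell of the next edge is reached, hence in `R`, and the edge
stays open. -/
lemma reachable_extend_glue {K : Finset (ℤ × ℤ)} {k : ℕ} {R : Finset K}
    {ω : K → (Label → Bool)} (hR : reachedCells K k (glue R ω ⊥) ⊆ R) {z v : ℤ × ℤ}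
    (hz : supNorm z = k) (h : (openGraph (extend K ω)).Reachable z v) :
    (openGraph (extend K (glue R ω ⊥))).Reachable z v := by
  rw [SimpleGraph.reachable_iff_reflTransGen] at h
  induction h with
  | refl => exact SimpleGraph.Reachable.refl _
  | @tail b c _ hbc ih =>
    refine ih.trans (SimpleGraph.Adj.reachable ?_)
    obtain ⟨hadj, ho⟩ := hbc
    refine ⟨hadj, ?_⟩
    obtain ⟨d, l, hd⟩ := exists_edgeOf ⟨s(b, c), hadj⟩
    rw [← hd, extend_edgeOf] at ho ⊢
    have hdK : d ∈ K := by
      by_contra hdK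
      simp [hdK] at ho
    have hb : b = tail d l ∨ b = head d l := by
      have : b ∈ s(tail d l, head d l) := by
        have h' : s(tail d l, head d l) = s(b, c) := congrArg Subtype.val hd
        rw [h']; exact Sym2.mem_mk_left _ _
      exact Sym2.mem_iff.mp this
    have hdR : (⟨d, hdK⟩ : K) ∈ R :=
      hR ⟨l, b, hb, z, by simpa using hz, ih.symm⟩
    simpa [hdK, glue, hdR] using ho

/-- A path from the origin to `∂B(n)` meets the sphere of radius `k`; seen from there, both its ends
are found by the exploration. -/
lemma armEvent_glue {n k : ℕ} (hkn : k ≤ n) (R : Finset (boxWindow n))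
    (ω : boxWindow n → (Label → Bool))
    (hR : reachedCells (boxWindow n) k (glue R ω ⊥) ⊆ R) (hω : ω ∈ armEvent n) :
    glue R ω ⊥ ∈ armEvent n := by
  obtain ⟨y, hy, hr⟩ := hω
  obtain ⟨z, hz, hrz⟩ := exists_reachable_supNorm_eq hr 0 (k := k) (by simp [supNorm])
    (by rw [hy]; exact hkn)
  rw [sub_zero] at hz
  refine ⟨y, hy, ?_⟩
  exact (reachable_extend_glue hR hz hrz.symm).symm.trans
    (reachable_extend_glue hR hz (hrz.symm.trans hr))

lemma reachable_corner_tail {η : Edge → Bool} {c : ℤ × ℤ} (h : ∀ l, η (edgeOf c l) = true)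
    (l : Label) : (openGraph η).Reachable (corner c) (tail c l) := by
  have hadj : ∀ l : Label, (openGraph η).Adj (tail c l) (head c l) := fun l =>
    ⟨adj_tail_head c l, h l⟩
  have h1 : ∀ i : ℕ, i < 6 → (openGraph η).Reachable (corner c) (6 * c.1 + i, 5 * c.2) := by
    intro i
    induction i with
    | zero => intro _; simp [corner]
    | succ i ih =>
      intro hi
      refine (ih (by omega)).trans (SimpleGraph.Adj.reachable ?_)
      have := hadj (⟨i, by omega⟩, 0, true)
      simpa [tail, head, add_assoc] using this
  have h2 : ∀ (i j : ℕ), i < 6 → j < 5 →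
      (openGraph η).Reachable (corner c) (6 * c.1 + i, 5 * c.2 + j) := by
    intro i j hi
    induction j with
    | zero => intro _; simpa using h1 i hi
    | succ j ih =>
      intro hj
      refine (ih (by omega)).trans (SimpleGraph.Adj.reachable ?_)
      have := hadj (⟨i, hi⟩, ⟨j, by omega⟩, false)
      simpa [tail, head, add_assoc] using this
  exact h2 l.1 l.2.1 l.1.2 l.2.1.2

lemma reachable_corner_of_end {η : Edge → Bool} {c : ℤ × ℤ} (h : ∀ l, η (edgeOf c l) = true)
    {l : Label} {v : ℤ × ℤ} (hv : v = tail c l ∨ v = head c l) :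
    (openGraph η).Reachable (corner c) v := by
  rcases hv with rfl | rfl
  · exact reachable_corner_tail h l
  · exact (reachable_corner_tail h l).trans
      (SimpleGraph.Adj.reachable ⟨adj_tail_head c l, h l⟩)

/-- If the cell is reached, opening all its edges connects its corner to the sphere of radius `k`,
whose distance from the corner is at least the difference of the radii. The factor is the price of
the fully open state. -/
lemma stateWeight_top_mul_reachedCells_le (K : Finset (ℤ × ℤ)) (k : ℕ) (t : ℝ) (c : K) :
    stateWeight t ⊤ * productProb (fun _ => stateWeight t) {ω | c ∈ reachedCells K k ω} ≤
      theta (Nat.dist k (supNorm (corner c))) t := by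
  classical
  set w : K → (Label → Bool) → ℝ := fun _ => stateWeight t with hw
  have hw0 : ∀ i x, 0 ≤ w i x := fun _ x => stateWeight_nonneg t x
  set A : Set (K → (Label → Bool)) :=
    {ω | ConnectedToSphere (extend K ω) (corner c) 0 k} with hA
  have hsub : {ω | c ∈ reachedCells K k ω} ⊆ {ω | Function.update ω c ⊤ ∈ A} := by
    rintro ω ⟨l, v, hv, z, hz, hr⟩
    have hle : ω ≤ Function.update ω c ⊤ := fun i => by
      by_cases hi : i = c
      · subst hi; simp
      · simp [hi]
    refine ⟨z, hz, SimpleGraph.Reachable.trans (reachable_corner_of_end (fun l => ?_) hv)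
      (hr.mono (openGraph_mono (extend_mono K hle)))⟩
    rw [extend_edgeOf, dif_pos c.2]
    simp
  have h1 : stateWeight t ⊤ * productProb w {ω | Function.update ω c ⊤ ∈ A} ≤
      productProb w A := mul_productProb_update_le hw0 c (sum_stateWeight t) ⊤ A
  refine (mul_le_mul_of_nonneg_left (productProb_mono hw0 hsub) (stateWeight_nonneg t ⊤)).trans
    (h1.trans ?_)
  rw [hw, productProb_stateWeight]
  refine le_trans (measureReal_mono ?_) (measure_connectedToSphere_corner_le c _ t)
  intro U hU
  obtain ⟨z, hz, hr⟩ := ConnectedToSphere.mono (extend_windowState_le K t U) hU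
  refine exists_reachable_supNorm_eq hr (corner c) (by simp [supNorm]) ?_
  simp only [supNorm, Nat.dist, Prod.fst_sub, Prod.snd_sub, Prod.fst_zero, Prod.snd_zero] at hz ⊢
  omega

/-- Moving `m` into the range, to `min m (n - 1)`, only shortens distances. Every distance is then
below `n` and occurs at most once on each side, whence the factor `2`. -/
lemma sum_range_dist_le {f : ℕ → ℝ} (hf : Antitone f) (hf0 : ∀ n, 0 ≤ f n) {n : ℕ} (hn : 1 ≤ n)
    (m : ℕ) : ∑ k ∈ Finset.range n, f (Nat.dist k m) ≤ 2 * ∑ k ∈ Finset.range n, f k := by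
  obtain ⟨m', hm'⟩ : ∃ m', m' = min m (n - 1) := ⟨_, rfl⟩
  have h1 : ∑ k ∈ Finset.range n, f (Nat.dist k m) ≤ ∑ k ∈ Finset.range n, f (Nat.dist k m') := by
    refine Finset.sum_le_sum fun k hk => hf ?_
    rw [Finset.mem_range] at hk
    unfold Nat.dist
    omega
  have himage : ∀ s : Finset ℕ, s ⊆ Finset.range n → Set.InjOn (fun k => Nat.dist k m') s →
      ∑ k ∈ s, f (Nat.dist k m') ≤ ∑ k ∈ Finset.range n, f k := by
    intro s hs hinj
    rw [← Finset.sum_image hinj]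
    refine Finset.sum_le_sum_of_subset_of_nonneg (fun j hj => ?_) fun j _ _ => hf0 j
    obtain ⟨k, hk, rfl⟩ := Finset.mem_image.mp hj
    have := Finset.mem_range.mp (hs hk)
    rw [Finset.mem_range]
    unfold Nat.dist
    omega
  rw [← Finset.sum_filter_add_sum_filter_not _ (fun k => k < m') fun k => f (Nat.dist k m')] at h1
  have h2 := himage ((Finset.range n).filter fun k => k < m') (Finset.filter_subset _ _)
    fun a ha b hb hab => by
      simp only [Finset.coe_filter, Set.mem_ofPred_eq] at ha hb
      simp only [Nat.dist] at hab
      omega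
  have h3 := himage ((Finset.range n).filter fun k => ¬ k < m') (Finset.filter_subset _ _)
    fun a ha b hb hab => by
      simp only [Finset.coe_filter, Set.mem_ofPred_eq] at ha hb
      simp only [Nat.dist] at hab
      omega
  linarith

/-- The expected number of pivotal cells is at least of order `n θₙ (1 - θₙ) / ∑ θₖ`. -/
lemma sum_pivotal_ge {n : ℕ} (hn : 1 ≤ n) (t : ℝ) :
    stateWeight t ⊤ * (n * (theta n t * (1 - theta n t))) ≤
      2 * (∑ k ∈ Finset.range n, theta k t) *
        ∑ c, productProb (fun _ => stateWeight t) (pivotal (armEvent n) c) := by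
  set w : boxWindow n → (Label → Bool) → ℝ := fun _ => stateWeight t with hw
  have hw0 : ∀ i x, 0 ≤ w i x := fun _ x => stateWeight_nonneg t x
  have hw1 : ∀ i, ∑ x, w i x = 1 := fun _ => sum_stateWeight t
  -- One OSSS inequality for each radius `k < n`; summing them averages the revelation
  -- probabilities.
  have hk : ∀ k ∈ Finset.range n, stateWeight t ⊤ * (theta n t * (1 - theta n t)) ≤
      ∑ c : boxWindow n, theta (Nat.dist k (supNorm (corner c))) t *
        productProb w (pivotal (armEvent n) c) := by
    intro k hk
    rw [theta_eq_productProb]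
    refine (mul_le_mul_of_nonneg_left (osss_inequality hw0 hw1 (isUpperSet_armEvent n)
      (reachedCells_mono _ k) (armEvent_glue (Finset.mem_range.mp hk).le))
      (stateWeight_nonneg t ⊤)).trans ?_
    rw [Finset.mul_sum]
    refine Finset.sum_le_sum fun c _ => ?_
    rw [← mul_assoc]
    exact mul_le_mul_of_nonneg_right (stateWeight_top_mul_reachedCells_le _ k t c)
      (productProb_nonneg hw0 _)
  have h := Finset.sum_le_sum hk
  rw [Finset.sum_const, Finset.card_range, nsmul_eq_mul, Finset.sum_comm] at h
  calc stateWeight t ⊤ * (n * (theta n t * (1 - theta n t)))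
      = n * (stateWeight t ⊤ * (theta n t * (1 - theta n t))) := by ring
    _ ≤ _ := h
    _ ≤ ∑ c, (2 * ∑ k ∈ Finset.range n, theta k t) * productProb w (pivotal (armEvent n) c) := by
        refine Finset.sum_le_sum fun c _ => ?_
        rw [← Finset.sum_mul]
        exact mul_le_mul_of_nonneg_right
          (sum_range_dist_le (theta_antitone t) (fun n => theta_nonneg n t) hn _)
          (productProb_nonneg hw0 _)
    _ = _ := (Finset.mul_sum _ _ _).symm

/-- The four edges at the origin lie in three cells; if these are closed, the origin is isolated. -/
lemma one_sub_theta_ge {n : ℕ} (hn : 1 ≤ n) (t : ℝ) :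
    stateWeight t ⊥ ^ 3 ≤ 1 - theta n t := by
  set K : Finset (ℤ × ℤ) := {(0, 0), (-1, 0), (0, -1)} with hK
  have hKc : K.card = 3 := by rw [hK]; rfl
  have h1 : clockMeasure.real {U | windowState K t U = ⊥} = stateWeight t ⊥ ^ 3 := by
    rw [measure_windowState_eq]
    simp [hKc]
  have h2 : {U | windowState K t U = ⊥} ⊆ {U | ConnectedToSphere (config t U) 0 0 1}ᶜ := by
    rintro U hU ⟨z, hz, hr⟩
    rw [SimpleGraph.reachable_iff_reflTransGen] at hr
    rcases hr.cases_head with h | ⟨v, ⟨hadj, ho⟩, -⟩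
    · rw [← h] at hz; simp [supNorm] at hz
    · obtain ⟨⟨r, s⟩, ⟨i, j, b⟩, hd⟩ := exists_edgeOf ⟨s(0, v), hadj⟩
      rw [← hd, config_edgeOf] at ho
      have hmem : (0 : ℤ × ℤ) = tail (r, s) (i, j, b) ∨ (0 : ℤ × ℤ) = head (r, s) (i, j, b) := by
        have : (0 : ℤ × ℤ) ∈ s(tail (r, s) (i, j, b), head (r, s) (i, j, b)) := by
          have h' : s(tail (r, s) (i, j, b), head (r, s) (i, j, b)) = s(0, v) :=
            congrArg Subtype.val hd
          rw [h']; exact Sym2.mem_mk_left _ _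
        exact Sym2.mem_iff.mp this
      have hrs : (r, s) ∈ K := by
        have hi := i.2; have hj := j.2
        simp only [hK, Finset.mem_insert, Finset.mem_singleton, Prod.mk.injEq]
        cases b <;> simp [tail, head, Prod.ext_iff] at hmem <;> omega
      have h0 : localConfig t (cellClocks U (r, s)) = ⊥ := congrFun hU ⟨(r, s), hrs⟩
      rw [h0] at ho
      simp at ho
  have h3 := measureReal_mono (μ := clockMeasure) h2
  rw [h1, measureReal_compl (measurableSet_connectedToSphere 1 t), ← theta_eq] at h3
  rw [probReal_univ] at h3
  have := theta_antitone t hn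
  simp only at this
  linarith

lemma sum_theta_pos {n : ℕ} (hn : 1 ≤ n) (t : ℝ) : 1 ≤ ∑ k ∈ Finset.range n, theta k t := by
  rw [← theta_zero t]
  exact Finset.single_le_sum (f := fun k => theta k t) (fun k _ => theta_nonneg k t)
    (Finset.mem_range.mpr hn)

/-- The differential inequality for the one-arm probabilities, in the form of a lower bound of their
increments. -/
theorem exists_theta_increment_ge {a b : ℝ} (ha : 0 < a) (hb : b < 1) :
    ∃ c > 0, ∀ n : ℕ, 1 ≤ n → ∃ C : ℝ, ∀ s t : ℝ, a ≤ s → s ≤ t → t ≤ b →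
      c * (n * theta n s / ∑ k ∈ Finset.range n, theta k s) * (t - s) - C * (t - s) ^ 2 ≤
        theta n t - theta n s := by
  classical
  -- The local estimates are used with cutoff `a / 2` for the central clock, and `m` then bounds
  -- from below all the clock intervals involved.
  set m := min (a / 2) (1 - b) with hm
  have hm0 : 0 < m := lt_min (by linarith) (by linarith)
  have hma : m ≤ a / 2 := min_le_left _ _
  have hmb : m ≤ 1 - b := min_le_right _ _
  set N := Fintype.card Label with hN
  set κ := m ^ (N - 1) with hκ
  have hκ0 : 0 < κ := pow_pos hm0 _
  set τ := (a / 2) ^ N with hτ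
  have hτ0 : 0 < τ := pow_pos (by linarith) _
  set ε := ((1 - b) ^ N) ^ 3 with hε
  have hε0 : 0 < ε := pow_pos (pow_pos (by linarith) _) _
  -- Here `κ` is the rate gained per pivotal cell, `τ` bounds the weight of the full state and `ε`
  -- bounds `1 - θₙ` from below; the `2` comes from `sum_pivotal_ge`. The error constant may depend
  -- on `n`, as it disappears under subdivision.
  refine ⟨κ * (τ * ε / 2), by positivity, fun n hn => ?_⟩
  refine ⟨(Fintype.card (boxWindow n) : ℝ) ^ 2 * (κ * (2 * N)), fun s t has hst htb => ?_⟩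
  have hs0 : 0 ≤ s := by linarith
  have ht1 : t ≤ 1 := by linarith
  have hrusso := russo_lower_bound (ι := boxWindow n) (p := stateWeight s) (q := stateWeight t)
    (stateWeight_nonneg s) (stateWeight_nonneg t) (sum_stateWeight s) (sum_stateWeight t)
    (sum_abs_stateWeight_sub_le hs0 hst ht1) (η := (t - s) * κ)
    (mul_nonneg (by linarith) hκ0.le)
    (fun B hB => by
      rw [sum_stateWeight_sub_mul]; exact sub_nonneg.mpr (localProb_mono hst hB))
    (fun B hB h0 h1 => by
      rw [sum_stateWeight_sub_mul]
      exact localProb_increment hm0.le hma (by linarith) hst (by linarith) hB h0 h1)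
    (isUpperSet_armEvent n)
  rw [← theta_eq_productProb, ← theta_eq_productProb] at hrusso
  set P := ∑ c, productProb (fun _ => stateWeight s) (pivotal (armEvent n) c) with hP
  set S := ∑ k ∈ Finset.range n, theta k s with hS
  have hS1 : 1 ≤ S := sum_theta_pos hn s
  have hpiv := sum_pivotal_ge hn s
  have htop : τ ≤ stateWeight s ⊤ :=
    le_stateWeight_top (by linarith) (by linarith) (by linarith)
  have hbot : ε ≤ 1 - theta n s := by
    refine le_trans ?_ (one_sub_theta_ge hn s)
    refine pow_le_pow_left₀ (pow_nonneg (by linarith) _) ?_ 3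
    exact (pow_le_pow_left₀ (by linarith) (by linarith) _).trans
      (le_stateWeight_bot hs0 (by linarith))
  have hθ := theta_nonneg n s
  have hP' : τ * ε / 2 * (n * theta n s / S) ≤ P := by
    have h1 : τ * (n * (theta n s * ε)) ≤
        stateWeight s ⊤ * (n * (theta n s * (1 - theta n s))) := by
      gcongr
      exact hτ0.le.trans htop
    have h2 : τ * (n * (theta n s * ε)) ≤ 2 * S * P := h1.trans hpiv
    rw [← mul_div_assoc, div_le_iff₀ (by linarith)]
    nlinarith
  have h4 := mul_le_mul_of_nonneg_left hP' (mul_nonneg (sub_nonneg.mpr hst) hκ0.le)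
  calc _ = (t - s) * κ * (τ * ε / 2 * (n * theta n s / S)) -
        (Fintype.card (boxWindow n) : ℝ) ^ 2 * ((t - s) * κ * (2 * (N * (t - s)))) := by ring
    _ ≤ _ := by linarith

end Exploration

/-! ### Consequences of the differential inequality -/

section Analysis

open Filter Topology

/-- Over `N + 1` equal steps the quadratic errors add up to `C (y - x)² / (N + 1)`, which tends to
`0`. -/
lemma le_increment_of_local {F : ℝ → ℝ} {K C x y : ℝ} (hxy : x ≤ y)
    (h : ∀ s t, x ≤ s → s ≤ t → t ≤ y → K * (t - s) - C * (t - s) ^ 2 ≤ F t - F s) :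
    K * (y - x) ≤ F y - F x := by
  have key : ∀ N : ℕ, K * (y - x) - C * (y - x) ^ 2 / ((N : ℝ) + 1) ≤ F y - F x := by
    intro N
    have hN : (0 : ℝ) < N + 1 := by positivity
    set δ := (y - x) / ((N : ℝ) + 1) with hδ
    have hδ0 : 0 ≤ δ := div_nonneg (by linarith) hN.le
    have hδN : ((N : ℝ) + 1) * δ = y - x := by rw [hδ]; field_simp
    have step : ∀ i : ℕ, i ≤ N + 1 → i * (K * δ - C * δ ^ 2) ≤ F (x + i * δ) - F x := by
      intro i
      induction i with
      | zero => intro _; simp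
      | succ i ih =>
        intro hi
        have h1 := ih (by omega)
        have hi' : ((i : ℝ) + 1) * δ ≤ (N + 1) * δ :=
          mul_le_mul_of_nonneg_right (by exact_mod_cast hi) hδ0
        have h2 := h (x + i * δ) (x + (i + 1) * δ) (by nlinarith [mul_nonneg i.cast_nonneg hδ0])
          (by linarith) (by linarith)
        have h3 : x + (i + 1) * δ - (x + i * δ) = δ := by ring
        rw [h3] at h2
        push_cast
        linarith
    have h1 := step (N + 1) le_rfl
    push_cast at h1
    rw [hδN, add_sub_cancel] at h1
    refine le_trans (le_of_eq ?_) h1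
    rw [hδ]
    field_simp
  have hlim : Tendsto (fun N : ℕ => K * (y - x) - C * (y - x) ^ 2 / ((N : ℝ) + 1)) atTop
      (𝓝 (K * (y - x) - 0)) := by
    refine tendsto_const_nhds.sub (Tendsto.const_div_atTop ?_ _)
    exact tendsto_atTop_add_const_right _ _ tendsto_natCast_atTop_atTop
  rw [sub_zero] at hlim
  exact le_of_tendsto' hlim key

/-- A discrete Grönwall argument: each of `N` equal steps multiplies `F` by at least `1 + L (y - x)
/ N`. -/
lemma le_exp_neg_of_growth {F : ℝ → ℝ} {L x y : ℝ} (hL : 0 ≤ L) (hxy : x ≤ y)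
    (hF0 : 0 ≤ F x) (hF1 : F y ≤ 1)
    (h : ∀ s t, x ≤ s → s ≤ t → t ≤ y → L * F s * (t - s) ≤ F t - F s) :
    F x ≤ Real.exp (-(L * (y - x))) := by
  have key : ∀ N : ℕ, (1 + L * (y - x) / (N : ℝ)) ^ N * F x ≤ 1 := by
    intro N
    -- For `N = 0` the power is `1` and the claim is `F x ≤ F y ≤ 1`.
    rcases Nat.eq_zero_or_pos N with rfl | hNpos
    · have h1 := h x y le_rfl hxy le_rfl
      have := mul_nonneg (mul_nonneg hL hF0) (sub_nonneg.mpr hxy)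
      simp only [pow_zero, one_mul]
      linarith
    have hN : (0 : ℝ) < N := by exact_mod_cast hNpos
    set δ := (y - x) / (N : ℝ) with hδ
    have hδ0 : 0 ≤ δ := div_nonneg (by linarith) hN.le
    have hδN : (N : ℝ) * δ = y - x := by rw [hδ]; field_simp
    have step : ∀ i : ℕ, i ≤ N → (1 + L * δ) ^ i * F x ≤ F (x + i * δ) := by
      intro i
      induction i with
      | zero => intro _; simp
      | succ i ih =>
        intro hi
        have h1 := ih (by omega)
        have hi' : ((i : ℝ) + 1) * δ ≤ N * δ :=
          mul_le_mul_of_nonneg_right (by exact_mod_cast hi) hδ0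
        have h2 := h (x + i * δ) (x + (i + 1) * δ) (by nlinarith [mul_nonneg i.cast_nonneg hδ0])
          (by linarith) (by linarith)
        have h3 : x + (i + 1) * δ - (x + i * δ) = δ := by ring
        rw [h3] at h2
        push_cast
        calc (1 + L * δ) ^ (i + 1) * F x = (1 + L * δ) * ((1 + L * δ) ^ i * F x) := by ring
          _ ≤ (1 + L * δ) * F (x + i * δ) :=
            mul_le_mul_of_nonneg_left h1 (by nlinarith [mul_nonneg hL hδ0])
          _ ≤ _ := by linarith
    have h1 := step N le_rfl
    rw [hδN, add_sub_cancel] at h1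
    have h4 : L * (y - x) / N = L * δ := by rw [hδ]; ring
    rw [h4]
    exact h1.trans hF1
  have hlim := (Real.tendsto_one_add_div_pow_exp (L * (y - x))).mul_const (F x)
  have h1 := le_of_tendsto' hlim key
  rw [Real.exp_neg, ← one_div, le_div_iff₀ (Real.exp_pos _), mul_comm]
  exact h1

/-- A decreasing sequence of increasing functions with values in `[0, 1]` satisfying on `[a, b]`,
in integrated form, the differential inequality `fₙ' ≥ c n fₙ / ∑ k < n, fₖ`. -/
structure GrowthFamily (f : ℕ → ℝ → ℝ) (a b c : ℝ) : Prop where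
  pos : 0 < c
  nonneg : ∀ n t, 0 ≤ f n t
  zero : ∀ t, f 0 t = 1
  anti : ∀ t, Antitone fun n => f n t
  mono : ∀ n, Monotone (f n)
  growth : ∀ n : ℕ, 1 ≤ n → ∃ C : ℝ, ∀ s t : ℝ, a ≤ s → s ≤ t → t ≤ b →
    c * (n * f n s / ∑ k ∈ Finset.range n, f k s) * (t - s) - C * (t - s) ^ 2 ≤ f n t - f n s

namespace GrowthFamily

variable {f : ℕ → ℝ → ℝ} {a b c : ℝ}

lemma le_one (h : GrowthFamily f a b c) (n : ℕ) (t : ℝ) : f n t ≤ 1 :=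
  (h.anti t (Nat.zero_le n)).trans_eq (h.zero t)

lemma one_le_sum (h : GrowthFamily f a b c) {n : ℕ} (hn : 1 ≤ n) (t : ℝ) :
    1 ≤ ∑ k ∈ Finset.range n, f k t := by
  rw [← h.zero t]
  exact Finset.single_le_sum (f := fun k => f k t) (fun k _ => h.nonneg k t)
    (Finset.mem_range.mpr hn)

lemma sum_mono (h : GrowthFamily f a b c) (n : ℕ) {s t : ℝ} (hst : s ≤ t) :
    ∑ k ∈ Finset.range n, f k s ≤ ∑ k ∈ Finset.range n, f k t :=
  Finset.sum_le_sum fun k _ => h.mono k hst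

lemma sum_le (h : GrowthFamily f a b c) (n : ℕ) (t : ℝ) :
    ∑ k ∈ Finset.range n, f k t ≤ n := by
  refine (Finset.sum_le_card_nsmul _ _ 1 fun k _ => h.le_one k t).trans_eq (by simp)

/-- The sums increase with time, so the bound `M` at `y` holds throughout `[x, y]` and the growth
rate there is at least `c n / M`. -/
lemma le_exp (h : GrowthFamily f a b c) {n : ℕ} (hn : 1 ≤ n) {x y M : ℝ} (hax : a ≤ x)
    (hxy : x ≤ y) (hyb : y ≤ b) (hM : ∑ k ∈ Finset.range n, f k y ≤ M) :
    f n x ≤ Real.exp (-(c * n / M * (y - x))) := by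
  have hM0 : 0 < M := by linarith [h.one_le_sum hn y]
  refine le_exp_neg_of_growth (by have := h.pos; positivity) hxy (h.nonneg _ _) (h.le_one _ _) ?_
  intro s t hxs hst hty
  obtain ⟨C, hC⟩ := h.growth n hn
  refine le_increment_of_local (C := C) hst fun s' t' hs hst' ht => ?_
  refine le_trans ?_ (hC s' t' (by linarith) hst' (by linarith))
  have h1 : ∑ k ∈ Finset.range n, f k s' ≤ M := (h.sum_mono n (by linarith)).trans hM
  have h2 := h.one_le_sum hn s'
  have h3 : f n s ≤ f n s' := h.mono n hs
  have h4 : n * f n s / M ≤ n * f n s' / ∑ k ∈ Finset.range n, f k s' := by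
    have := h.nonneg n s'
    gcongr
  have h5 : c * n / M * f n s = c * (n * f n s / M) := by ring
  rw [h5]
  have h6 := mul_le_mul_of_nonneg_right (mul_le_mul_of_nonneg_left h4 h.pos.le)
    (sub_nonneg.mpr hst')
  linarith

lemma summable_exp_neg_sqrt {γ : ℝ} (hγ : 0 < γ) :
    Summable fun n : ℕ => Real.exp (-(γ * Real.sqrt n)) := by
  -- The exponent `4` turns `√n` into `n²`, giving a comparison with `1 / n²`.
  have h1 : Tendsto (fun x : ℝ => x ^ (4 : ℝ) * Real.exp (-γ * x)) atTop (𝓝 0) :=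
    tendsto_rpow_mul_exp_neg_mul_atTop_nhds_zero 4 γ hγ
  have h2 := h1.comp (Real.tendsto_sqrt_atTop.comp (tendsto_natCast_atTop_atTop (R := ℝ)))
  have h3 : ∀ᶠ n : ℕ in atTop, Real.exp (-(γ * Real.sqrt n)) ≤ 1 / (n : ℝ) ^ 2 := by
    filter_upwards [h2.eventually_le_const (show (0 : ℝ) < 1 by norm_num), eventually_gt_atTop 0]
      with n hn hn0
    have hn0' : (0 : ℝ) < n := by exact_mod_cast hn0
    simp only [Function.comp_apply] at hn
    have h4 : Real.sqrt n ^ (4 : ℝ) = (n : ℝ) ^ 2 := by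
      have : (4 : ℝ) = ((4 : ℕ) : ℝ) := by norm_num
      rw [this, Real.rpow_natCast]
      calc Real.sqrt n ^ 4 = (Real.sqrt n ^ 2) ^ 2 := by ring
        _ = _ := by rw [Real.sq_sqrt hn0'.le]
    rw [h4, neg_mul] at hn
    rw [le_div_iff₀ (by positivity), mul_comm]
    exact hn
  refine Summable.of_norm_bounded_eventually_nat (g := fun n : ℕ => 1 / (n : ℝ) ^ 2)
    (Real.summable_one_div_nat_pow.mpr one_lt_two) ?_
  filter_upwards [h3] with n hn
  rwa [Real.norm_of_nonneg (Real.exp_pos _).le]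

/-- Exponential decay strictly below a point where the sums grow at most like a square root. -/
lemma exists_exp_decay (h : GrowthFamily f a b c) {x y : ℝ} (hax : a ≤ x) (hxy : x < y)
    (hyb : y ≤ b) {C : ℝ}
    (hC : ∀ n : ℕ, 1 ≤ n → ∑ k ∈ Finset.range n, f k y ≤ C * Real.sqrt n) :
    ∃ γ > 0, ∀ n : ℕ, 1 ≤ n → f n x ≤ Real.exp (-γ * n) := by
  have hc := h.pos
  have hC0 : 0 < C := by
    have h1 := h.one_le_sum le_rfl y
    have h2 := hC 1 le_rfl
    simp only [Nat.cast_one, Real.sqrt_one, mul_one] at h2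
    linarith
  -- On `[z, y]` the square-root bound gives decay like `exp(-γ √n)` at `z`. This is summable, so
  -- the sums are bounded at `z`, and `[x, z]` then yields exponential decay.
  set z := (x + y) / 2 with hz
  have h1 : ∀ n : ℕ, f n z ≤ Real.exp (-(c * (y - z) / C * Real.sqrt n)) := by
    intro n
    rcases Nat.eq_zero_or_pos n with rfl | hn
    · simp [h.zero]
    · refine (h.le_exp hn (by linarith) (by linarith) hyb (hC n hn)).trans_eq ?_
      have hn0 : (0 : ℝ) < n := by exact_mod_cast hn
      have hs : 0 < Real.sqrt n := Real.sqrt_pos.mpr hn0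
      congr 2
      field_simp
      rw [Real.sq_sqrt hn0.le]
  have hγ : 0 < c * (y - z) / C := div_pos (mul_pos hc (by linarith)) hC0
  have hsum := summable_exp_neg_sqrt hγ
  set M := ∑' n : ℕ, Real.exp (-(c * (y - z) / C * Real.sqrt n)) with hM
  have h2 : ∀ n, ∑ k ∈ Finset.range n, f k z ≤ M := fun n =>
    (Finset.sum_le_sum fun k _ => h1 k).trans
      (hsum.sum_le_tsum _ fun k _ => (Real.exp_pos _).le)
  have hM0 : 0 < M := by linarith [h2 1, h.one_le_sum le_rfl z]
  refine ⟨c * (z - x) / M, div_pos (mul_pos hc (by linarith)) hM0, fun n hn => ?_⟩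
  refine (h.le_exp hn hax (by linarith) (by linarith) (h2 n)).trans_eq ?_
  congr 1
  ring

/-- The logarithms telescope, and `log (1 + u) ≤ u` bounds each increment. -/
lemma log_sum_le (h : GrowthFamily f a b c) (t : ℝ) (n : ℕ) :
    Real.log (∑ k ∈ Finset.range (n + 1), f k t) ≤
      ∑ i ∈ Finset.Icc 1 n, f i t / ∑ k ∈ Finset.range i, f k t := by
  induction n with
  | zero => simp [h.zero]
  | succ n ih =>
    rw [Finset.sum_Icc_succ_top (by omega), Finset.sum_range_succ]
    set S := ∑ k ∈ Finset.range (n + 1), f k t with hS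
    have hS1 : 1 ≤ S := h.one_le_sum (by omega) t
    have hf := h.nonneg (n + 1) t
    have h1 : S + f (n + 1) t = S * (1 + f (n + 1) t / S) := by field_simp
    have h2 : 0 ≤ f (n + 1) t / S := div_nonneg hf (by linarith)
    rw [h1, Real.log_mul (by linarith) (by linarith)]
    have h3 := Real.log_le_sub_one_of_pos (show 0 < 1 + f (n + 1) t / S by linarith)
    linarith

/-- Dividing the growth inequality by `i` and summing over `i` produces the right side of
`log_sum_le`. So `∑ fᵢ / i` grows in time at rate at least `c log ∑ fₖ`. -/
lemma log_sum_mul_le (h : GrowthFamily f a b c) {x y : ℝ} (hax : a ≤ x) (hxy : x ≤ y)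
    (hyb : y ≤ b) (n : ℕ) :
    c * Real.log (∑ k ∈ Finset.range (n + 1), f k x) * (y - x) ≤
      ∑ i ∈ Finset.Icc 1 n, f i y / i := by
  have hc := h.pos
  have hgrow : ∀ i ∈ Finset.Icc 1 n, ∃ C : ℝ, ∀ s t : ℝ, a ≤ s → s ≤ t → t ≤ b →
    c * (i * f i s / ∑ k ∈ Finset.range i, f k s) * (t - s) - C * (t - s) ^ 2 ≤ f i t - f i s :=
    fun i hi => h.growth i (Finset.mem_Icc.mp hi).1
  choose! C hC using hgrow
  have key := le_increment_of_local (F := fun t => ∑ i ∈ Finset.Icc 1 n, f i t / i)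
    (K := c * Real.log (∑ k ∈ Finset.range (n + 1), f k x))
    (C := ∑ i ∈ Finset.Icc 1 n, C i / i) hxy fun s t hs hst ht => ?_
  · have : 0 ≤ ∑ i ∈ Finset.Icc 1 n, f i x / i :=
      Finset.sum_nonneg fun i _ => div_nonneg (h.nonneg _ _) i.cast_nonneg
    linarith
  · have h1 : Real.log (∑ k ∈ Finset.range (n + 1), f k x) ≤
        ∑ i ∈ Finset.Icc 1 n, f i s / ∑ k ∈ Finset.range i, f k s :=
      (Real.log_le_log (by linarith [h.one_le_sum (show 1 ≤ n + 1 by omega) x])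
        (h.sum_mono _ hs)).trans (h.log_sum_le s n)
    have h2 := mul_le_mul_of_nonneg_right (mul_le_mul_of_nonneg_left h1 hc.le)
      (sub_nonneg.mpr hst)
    refine (sub_le_sub_right h2 _).trans ?_
    rw [Finset.mul_sum, Finset.sum_mul, Finset.sum_mul, ← Finset.sum_sub_distrib,
      ← Finset.sum_sub_distrib]
    refine Finset.sum_le_sum fun i hi => ?_
    have hi0 : (0 : ℝ) < i := by exact_mod_cast (Finset.mem_Icc.mp hi).1
    rw [← sub_div, le_div_iff₀ hi0]
    refine le_trans (le_of_eq ?_) (hC i hi s t (by linarith) hst (by linarith))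
    field_simp

/-- Linear growth of the limit above a point where the sums are not bounded by a square root. -/
lemma linear_le_limit (h : GrowthFamily f a b c) {x y θ : ℝ} (hax : a ≤ x) (hxy : x ≤ y)
    (hyb : y ≤ b)
    (hx : ¬ ∃ C : ℝ, ∀ n : ℕ, 1 ≤ n → ∑ k ∈ Finset.range n, f k x ≤ C * Real.sqrt n)
    (hθ : Tendsto (fun n => f n y) atTop (𝓝 θ)) :
    c / 2 * (y - x) ≤ θ := by
  have hc := h.pos
  have hθ0 : 0 ≤ θ := ge_of_tendsto' hθ fun n => h.nonneg n y
  refine le_of_forall_pos_lt_add fun ε hε => ?_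
  by_contra! hcon
  set ρ := θ + ε / 2 with hρ
  have hρ0 : 0 ≤ ρ := by linarith
  obtain ⟨N, hN⟩ := eventually_atTop.mp (hθ.eventually_le_const (show θ < ρ by linarith))
  -- The terms below `N` contribute at most `1` each, the others at most `ρ` times the harmonic sum.
  have hW : ∀ n : ℕ, ∑ i ∈ Finset.Icc 1 n, f i y / i ≤ N + ρ * (1 + Real.log n) := by
    intro n
    have h1 : ∀ i ∈ Finset.Icc 1 n, f i y / i ≤ (if i < N then 1 else 0) + ρ * (i : ℝ)⁻¹ := by
      intro i hi
      have hi1 : (1 : ℝ) ≤ i := by exact_mod_cast (Finset.mem_Icc.mp hi).1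
      have hinv : (0 : ℝ) ≤ (i : ℝ)⁻¹ := by positivity
      rw [div_eq_mul_inv]
      split_ifs with hiN
      · have : f i y * (i : ℝ)⁻¹ ≤ 1 :=
          mul_le_one₀ (h.le_one _ _) hinv (inv_le_one_of_one_le₀ hi1)
        have := mul_nonneg hρ0 hinv
        linarith
      · rw [zero_add]
        exact mul_le_mul_of_nonneg_right (hN i (not_lt.mp hiN)) hinv
    refine (Finset.sum_le_sum h1).trans ?_
    rw [Finset.sum_add_distrib, ← Finset.mul_sum]
    refine add_le_add ?_ (mul_le_mul_of_nonneg_left ?_ hρ0)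
    · rw [Finset.sum_ite, Finset.sum_const_zero, add_zero, Finset.sum_const, nsmul_eq_mul, mul_one]
      have : (Finset.Icc 1 n).filter (· < N) ⊆ Finset.range N := fun i hi =>
        Finset.mem_range.mpr (Finset.mem_filter.mp hi).2
      exact_mod_cast (Finset.card_le_card this).trans_eq (Finset.card_range N)
    · have := harmonic_le_one_add_log n
      rw [harmonic_eq_sum_Icc] at this
      push_cast at this
      exact this
  push Not at hx
  -- The sums at `x` exceed `√n` for some `n` with `log √n > B + 1`, hence their logarithm is at
  -- least half of `log n`; this is the factor `1 / 2` in the slope. The assumed strict failure by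
  -- `ε` would force `ε log √n ≤ N + ρ`, contradicting the choice of `B`.
  set B := 2 * (N + ρ) / ε with hB
  obtain ⟨n, hn, hS⟩ := hx (Real.exp (B + 1))
  have hn0 : (0 : ℝ) < n := by exact_mod_cast hn
  have hs0 : 0 < Real.sqrt n := Real.sqrt_pos.mpr hn0
  have hB0 : 0 ≤ B := by positivity
  have hexp1 : 1 ≤ Real.exp (B + 1) := Real.one_le_exp (by linarith)
  have hsq : Real.sqrt n * Real.sqrt n = n := Real.mul_self_sqrt hn0.le
  have hn1 : Real.exp (B + 1) < Real.sqrt n := by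
    have h1 := hS.trans_le (h.sum_le n x)
    nlinarith
  have hlogs : B + 1 < Real.log (Real.sqrt n) := by
    rw [Real.lt_log_iff_exp_lt hs0]; exact hn1
  have hlogn : Real.log n = 2 * Real.log (Real.sqrt n) := by
    rw [Real.log_sqrt hn0.le]; ring
  have hlogS : Real.log (Real.sqrt n) ≤ Real.log (∑ k ∈ Finset.range (n + 1), f k x) := by
    refine Real.log_le_log hs0 ?_
    rw [Finset.sum_range_succ]
    have := h.nonneg n x
    nlinarith
  have h1 := h.log_sum_mul_le hax hxy hyb n
  have h2 := h1.trans (hW n)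
  set ℓ := Real.log (Real.sqrt n) with hℓ
  have h3 : c * ℓ * (y - x) ≤ N + ρ * (1 + Real.log n) :=
    le_trans (mul_le_mul_of_nonneg_right (mul_le_mul_of_nonneg_left hlogS hc.le)
      (sub_nonneg.mpr hxy)) h2
  rw [hlogn] at h3
  have h4 : ε * B = 2 * (N + ρ) := by rw [hB]; field_simp
  have h5 : (θ + ε) * (2 * ℓ) ≤ c / 2 * (y - x) * (2 * ℓ) :=
    mul_le_mul_of_nonneg_right hcon (by linarith)
  have hN0 : (0 : ℝ) ≤ N := N.cast_nonneg
  nlinarith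

end GrowthFamily

end Analysis

/-! ### Path counting at small times -/

section PathCounting

/-- The four unit vectors of the lattice. -/
def unitStep (k : Fin 4) : ℤ × ℤ := ![(1, 0), (-1, 0), (0, 1), (0, -1)] k

lemma adj_add_unitStep (v : ℤ × ℤ) (k : Fin 4) : lattice.Adj v (v + unitStep k) := by
  rw [lattice_adj_iff]
  fin_cases k <;> simp [unitStep]

lemma exists_eq_add_unitStep {u v : ℤ × ℤ} (h : lattice.Adj u v) : ∃ k, v = u + unitStep k := by
  rw [lattice_adj_iff] at h
  rcases h with ⟨h1, h2 | h2⟩ | ⟨h1, h2 | h2⟩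
  · exact ⟨3, by ext <;> simp [unitStep] <;> omega⟩
  · exact ⟨2, by ext <;> simp [unitStep] <;> omega⟩
  · exact ⟨1, by ext <;> simp [unitStep] <;> omega⟩
  · exact ⟨0, by ext <;> simp [unitStep] <;> omega⟩

/-- The position after `i` steps of the walk from the origin with the given steps. -/
def walkPosition (d : ℕ → Fin 4) : ℕ → ℤ × ℤ
  | 0 => 0
  | i + 1 => walkPosition d i + unitStep (d i)

/-- The edge crossed in step `i` of the walk from the origin with the given steps. -/
def walkEdge (d : ℕ → Fin 4) (i : ℕ) : Edge :=
  ⟨s(walkPosition d i, walkPosition d (i + 1)), adj_add_unitStep _ _⟩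

/-- The event that the walk with the given steps has `n` distinct edges, all with clocks up to
time `t`. -/
def walkEvent (n : ℕ) (t : ℝ) (d : ℕ → Fin 4) : Set Clocks :=
  {U | Set.InjOn (walkEdge d) (Set.Iio n) ∧ ∀ i < n, (U (walkEdge d i) : ℝ) ≤ t}

/-- Distinctness of the edges makes their clocks independent; if it fails, the event is empty. -/
lemma measure_walkEvent_le (n : ℕ) {t : ℝ} (h0 : 0 ≤ t) (h1 : t ≤ 1) (d : ℕ → Fin 4) :
    clockMeasure.real (walkEvent n t d) ≤ t ^ n := by
  classical
  by_cases hinj : Set.InjOn (walkEdge d) (Set.Iio n)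
  · have hsub : walkEvent n t d ⊆ Set.pi ((Finset.range n).image (walkEdge d))
        fun _ => {x : unitInterval | (x : ℝ) ≤ t} := by
      rintro U ⟨-, hU⟩ e he
      obtain ⟨i, hi, rfl⟩ := Finset.mem_image.mp (Finset.mem_coe.mp he)
      exact hU i (Finset.mem_range.mp hi)
    refine (measureReal_mono hsub).trans_eq ?_
    rw [measureReal_def, clockMeasure, Measure.infinitePi_pi _ fun _ _ =>
      measurableSet_le measurable_subtype_coe measurable_const, Finset.prod_const,
      ENNReal.toReal_pow, Finset.card_image_of_injOn (by simpa using hinj), Finset.card_range]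
    congr 1
    exact volume_real_unitInterval_Iic h0 h1
  · have : walkEvent n t d = ∅ := Set.eq_empty_of_forall_notMem fun U hU => hinj hU.1
    rw [this]
    simpa using pow_nonneg h0 n

/-- The steps given by a finite sequence, followed by steps to the right. -/
def extendSteps {n : ℕ} (D : Fin n → Fin 4) (i : ℕ) : Fin 4 := if h : i < n then D ⟨i, h⟩ else 0

lemma supNorm_le_length {u v : ℤ × ℤ} {η : Edge → Bool} (p : (openGraph η).Walk u v) :
    supNorm (v - u) ≤ p.length := by
  induction p with
  | nil => simp [supNorm]
  | @cons u w v h p ih =>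
    have := supNorm_sub_le_of_adj h.1.symm v
    have h1 : supNorm (v - u) = supNorm (u - v) := by
      simp only [supNorm, Prod.fst_sub, Prod.snd_sub]; omega
    have h2 : supNorm (v - w) = supNorm (w - v) := by
      simp only [supNorm, Prod.fst_sub, Prod.snd_sub]; omega
    rw [SimpleGraph.Walk.length_cons]
    omega

/-- A self-avoiding open path to distance `n` has at least `n` edges, and its first `n` are
distinct. An open edge has rung whatever `C_{r,s}` does. -/
lemma exists_mem_walkEvent {n : ℕ} {t : ℝ} {U : Clocks}
    (h : ConnectedToSphere (config t U) 0 0 n) :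
    ∃ D : Fin n → Fin 4, U ∈ walkEvent n t (extendSteps D) := by
  classical
  obtain ⟨z, hz, hr⟩ := h
  obtain ⟨p, hp⟩ := hr.exists_isPath
  have hlen : n ≤ p.length := hz ▸ supNorm_le_length p
  have hadj : ∀ i : Fin n, (openGraph (config t U)).Adj (p.getVert i) (p.getVert (i + 1)) :=
    fun i => p.adj_getVert_succ (by omega)
  choose D hD using fun i : Fin n => exists_eq_add_unitStep (hadj i).1
  refine ⟨D, ?_⟩
  have hpos : ∀ i ≤ n, walkPosition (extendSteps D) i = p.getVert i := by
    intro i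
    induction i with
    | zero => intro _; simp [walkPosition]
    | succ i ih =>
      intro hi
      have hi' : i < n := by omega
      rw [walkPosition, ih hi'.le, hD ⟨i, hi'⟩]
      simp [extendSteps, hi']
  have hinj : ∀ i ≤ n, ∀ j ≤ n, p.getVert i = p.getVert j → i = j := fun i hi j hj hij =>
    hp.getVert_injOn (show i ≤ p.length by omega) (show j ≤ p.length by omega) hij
  refine ⟨fun i hi j hj hij => ?_, fun i hi => ?_⟩
  · simp only [Set.mem_Iio] at hi hj
    have h' := congrArg Subtype.val hij
    simp only [walkEdge] at h'
    rw [hpos i hi.le, hpos j hj.le, hpos (i + 1) hi, hpos (j + 1) hj, Sym2.eq_iff] at h'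
    rcases h' with ⟨h1, -⟩ | ⟨h1, h2⟩
    · exact hinj i hi.le j hj.le h1
    · have := hinj i hi.le (j + 1) hj h1
      have := hinj (i + 1) hi j hj.le h2
      omega
  · obtain ⟨hl, ho⟩ := hadj ⟨i, hi⟩
    have he : walkEdge (extendSteps D) i = ⟨s(p.getVert i, p.getVert (i + 1)), hl⟩ :=
      Subtype.ext (by simp only [walkEdge]; rw [hpos i hi.le, hpos (i + 1) hi])
    rw [he]
    simp only [config, decide_eq_true_eq] at ho
    exact ho.1

lemma theta_le_pow (n : ℕ) {t : ℝ} (h0 : 0 ≤ t) (h1 : t ≤ 1) : theta n t ≤ (4 * t) ^ n := by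
  rw [theta_eq]
  have hsub : {U | ConnectedToSphere (config t U) 0 0 n} ⊆
      ⋃ D ∈ (Finset.univ : Finset (Fin n → Fin 4)), walkEvent n t (extendSteps D) := by
    intro U hU
    obtain ⟨D, hD⟩ := exists_mem_walkEvent hU
    exact Set.mem_biUnion (Finset.mem_univ D) hD
  refine (measureReal_mono hsub (measure_ne_top _ _)).trans
    ((measureReal_biUnion_finset_le _ _).trans ?_)
  refine (Finset.sum_le_card_nsmul _ _ _ fun D _ => measure_walkEvent_le n h0 h1 _).trans_eq ?_
  simp [mul_pow]

end PathCounting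

/-! ### The infinite cluster and the threshold -/

section InfiniteCluster

open Filter Topology

lemma infinite_cluster_iff (η : Edge → Bool) :
    (cluster η).Infinite ↔ ∀ n, ConnectedToSphere η 0 0 n := by
  constructor
  · intro h n
    have hfin : (box n).Finite := Set.finite_Icc _ _
    obtain ⟨v, hv, hvn⟩ := h.exists_notMem_finite hfin
    rw [mem_box_iff] at hvn
    exact exists_reachable_supNorm_eq hv 0 (by simp [supNorm]) (by rw [sub_zero]; omega)
  · intro h
    choose z hz hr using h
    refine Set.infinite_of_injective_forall_mem (f := z) (fun m n hmn => ?_) hr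
    rw [← hz m, ← hz n, hmn]

lemma thetaInf_eq (t : ℝ) :
    thetaInf t = clockMeasure.real (⋂ n, {U | ConnectedToSphere (config t U) 0 0 n}) := by
  unfold thetaInf prob
  congr 1
  ext U
  simp [infinite_cluster_iff]

lemma tendsto_theta (t : ℝ) : Tendsto (fun n => theta n t) atTop (𝓝 (thetaInf t)) := by
  simp only [theta_eq, thetaInf_eq, measureReal_def]
  refine (ENNReal.tendsto_toReal (measure_ne_top _ _)).comp ?_
  refine tendsto_measure_iInter_atTop
    (fun n => (measurableSet_connectedToSphere n t).nullMeasurableSet) ?_ ⟨0, measure_ne_top _ _⟩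
  exact fun m n hmn U hU => ConnectedToSphere.anti hmn hU

lemma thetaInf_nonneg (t : ℝ) : 0 ≤ thetaInf t := measureReal_nonneg

lemma thetaInf_le_theta (n : ℕ) (t : ℝ) : thetaInf t ≤ theta n t :=
  (theta_antitone t).le_of_tendsto (tendsto_theta t) n

lemma thetaInf_mono : Monotone thetaInf := fun s t hst =>
  le_of_tendsto_of_tendsto' (tendsto_theta s) (tendsto_theta t) fun n => theta_mono n hst

lemma thetaInf_eq_zero_of_le {t : ℝ} (h0 : 0 ≤ t) (h : t ≤ 1 / 8) : thetaInf t = 0 := by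
  refine le_antisymm ?_ (thetaInf_nonneg t)
  have hlim : Tendsto (fun n : ℕ => (4 * t) ^ n) atTop (𝓝 0) :=
    tendsto_pow_atTop_nhds_zero_of_lt_one (by linarith) (by linarith)
  exact ge_of_tendsto' hlim fun n =>
    (thetaInf_le_theta n t).trans (theta_le_pow n h0 (by linarith))

lemma bddAbove_subcritical : BddAbove {t ∈ Set.Icc (0 : ℝ) 1 | thetaInf t = 0} :=
  ⟨1, fun _ h => h.1.2⟩

lemma le_criticalTime : 1 / 8 ≤ criticalTime :=
  le_csSup bddAbove_subcritical
    ⟨⟨by norm_num, by norm_num⟩, thetaInf_eq_zero_of_le (by norm_num) le_rfl⟩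

lemma criticalTime_le_one : criticalTime ≤ 1 :=
  csSup_le ⟨0, ⟨le_rfl, zero_le_one⟩, thetaInf_eq_zero_of_le le_rfl (by norm_num)⟩
    fun _ h => h.1.2

lemma thetaInf_eq_zero_of_lt {t : ℝ} (ht : t < criticalTime) : thetaInf t = 0 := by
  have hne : {t ∈ Set.Icc (0 : ℝ) 1 | thetaInf t = 0}.Nonempty :=
    ⟨0, ⟨le_rfl, zero_le_one⟩, thetaInf_eq_zero_of_le le_rfl (by norm_num)⟩
  obtain ⟨s, hs, hts⟩ := exists_lt_of_lt_csSup hne ht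
  exact le_antisymm ((thetaInf_mono hts.le).trans_eq hs.2) (thetaInf_nonneg t)

lemma thetaInf_pos_of_gt {t : ℝ} (ht : criticalTime < t) (ht1 : t ≤ 1) : 0 < thetaInf t := by
  refine lt_of_le_of_ne (thetaInf_nonneg t) fun h => ?_
  refine absurd (le_csSup bddAbove_subcritical ⟨⟨?_, ht1⟩, h.symm⟩) (not_le.mpr ht)
  linarith [le_criticalTime]

lemma exists_growthFamily {b : ℝ} (hb : b < 1) : ∃ c, GrowthFamily theta (1 / 8) b c := by
  obtain ⟨c, hc, h⟩ := exists_theta_increment_ge (show (0 : ℝ) < 1 / 8 by norm_num) hb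
  exact ⟨c, hc, theta_nonneg, theta_zero, theta_antitone, theta_mono, h⟩

end InfiniteCluster

end IntermediateModel

end

/-! ### Sharpness of the phase transition -/

theorem theorem3 :
    (∀ t ∈ Set.Icc (0 : ℝ) 1, t < IntermediateModel.criticalTime →
      ∃ c : ℝ, 0 < c ∧ ∀ n : ℕ, 1 ≤ n →
        IntermediateModel.theta n t ≤ Real.exp (-c * (n : ℝ))) ∧
    (∃ c : ℝ, 0 < c ∧ ∀ t ∈ Set.Icc (0 : ℝ) 1, IntermediateModel.criticalTime < t →
      c * (t - IntermediateModel.criticalTime) ≤ IntermediateModel.thetaInf t) := by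
  open IntermediateModel in
  have hc0 := le_criticalTime
  have hc1 := criticalTime_le_one
  set τ := criticalTime with hτ
  constructor
  · intro t ht htc
    set r := max t (1 / 8) with hr
    -- The growth inequality is available only from time `1 / 8` on. If the threshold equals `1 /
    -- 8`, then `4 t ≤ 1 / 2` and path counting suffices.
    rcases hc0.eq_or_lt with heq | hlt
    · refine ⟨Real.log 2, Real.log_pos one_lt_two, fun n _ => ?_⟩
      refine (theta_le_pow n ht.1 ht.2).trans ?_
      calc (4 * t) ^ n ≤ (1 / 2) ^ n :=
            pow_le_pow_left₀ (by linarith [ht.1]) (by linarith) n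
        _ = Real.exp (-Real.log 2 * n) := by
            rw [neg_mul, mul_comm, ← mul_neg, Real.exp_nat_mul, Real.exp_neg,
              Real.exp_log two_pos, one_div]
    · have hrτ : r < τ := max_lt htc hlt
      have h8r : 1 / 8 ≤ r := le_max_right _ _
      set b := (r + τ) / 2 with hb
      obtain ⟨c, hG⟩ := exists_growthFamily (show b < 1 by linarith)
      set x := (r + b) / 2 with hx
      -- Otherwise the limit would be positive at `b`, which lies strictly below the threshold.
      have hsq : ∃ C : ℝ, ∀ n : ℕ, 1 ≤ n →
          ∑ k ∈ Finset.range n, theta k x ≤ C * Real.sqrt n := by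
        by_contra hcon
        have h1 := hG.linear_le_limit (by linarith) (show x ≤ b by linarith) le_rfl hcon
          (tendsto_theta b)
        rw [thetaInf_eq_zero_of_lt (by linarith)] at h1
        have h2 := mul_pos (half_pos hG.pos) (show 0 < b - x by linarith)
        linarith
      obtain ⟨C, hC⟩ := hsq
      obtain ⟨γ, hγ, h⟩ := hG.exists_exp_decay h8r (show r < x by linarith) (by linarith) hC
      exact ⟨γ, hγ, fun n hn => (theta_mono n (le_max_left t (1 / 8))).trans (h n hn)⟩
  · rcases hc1.eq_or_lt with heq | hlt
    · exact ⟨1, one_pos, fun t ht htc => absurd ht.2 (by linarith)⟩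
    set b := (1 + τ) / 2 with hb
    obtain ⟨c, hG⟩ := exists_growthFamily (show b < 1 by linarith)
    have hc := hG.pos
    have hlin : ∀ y, τ < y → y ≤ b → c / 2 * (y - τ) ≤ thetaInf y := by
      intro y hτy hyb
      refine le_of_forall_pos_le_add fun ε hε => ?_
      -- The dichotomy is applied at a point just above the threshold; moving from `τ` to `x` costs
      -- at most `ε` in the linear bound.
      obtain ⟨x, hx1, hx2⟩ := exists_between
        (show τ < min y (τ + ε / c) from lt_min hτy (by linarith [div_pos hε hc]))
      have hxy : x < y := hx2.trans_le (min_le_left _ _)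
      have hxε : x < τ + ε / c := hx2.trans_le (min_le_right _ _)
      have hpos := thetaInf_pos_of_gt hx1 (by linarith)
      have h1 := hG.linear_le_limit (by linarith) hxy.le hyb (fun ⟨C, hC⟩ => ?_) (tendsto_theta y)
      · have h2 : c * (x - τ) ≤ ε := by
          have : (x - τ) * c ≤ ε := by
            rw [← le_div_iff₀ hc]; linarith
          linarith
        nlinarith
      -- At `x` the sums are at least `n` times a positive limit, so a bound `C √n` fails once `√n`
      -- exceeds `C / thetaInf x`.
      · obtain ⟨n, hn⟩ := exists_nat_gt ((C / thetaInf x) ^ 2 + 1)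
        have hn1 : (1 : ℝ) < n := by nlinarith [sq_nonneg (C / thetaInf x)]
        have hn0 : 1 ≤ n := by exact_mod_cast hn1.le
        have h3 : n * thetaInf x ≤ C * Real.sqrt n := by
          refine le_trans ?_ (hC n hn0)
          have := Finset.card_nsmul_le_sum (Finset.range n) (fun k => theta k x) (thetaInf x)
            fun k _ => thetaInf_le_theta k x
          simpa using this
        have hs : 0 < Real.sqrt n := Real.sqrt_pos.mpr (by linarith)
        have hss : Real.sqrt n * Real.sqrt n = n := Real.mul_self_sqrt (by linarith)
        have h4 : Real.sqrt n ≤ C / thetaInf x := by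
          rw [le_div_iff₀ hpos]
          refine le_of_mul_le_mul_right ?_ hs
          calc Real.sqrt n * thetaInf x * Real.sqrt n = n * thetaInf x := by
                rw [mul_right_comm, hss]
            _ ≤ _ := h3
        nlinarith
    -- Beyond `b` only monotonicity is used: `b` is midway between `τ` and `1`, so the bound at `b`
    -- loses a further factor `2`.
    refine ⟨c / 4, by linarith, fun t ht htτ => ?_⟩
    rcases le_total t b with htb | hbt
    · have := hlin t htτ htb
      nlinarith
    · have h1 := (hlin b (by linarith) le_rfl).trans (thetaInf_mono hbt)
      refine le_trans ?_ h1
      have : b - τ = (1 - τ) / 2 := by rw [hb]; ring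
      rw [this]
      nlinarith [ht.2]
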